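/- **Executions and strong linearisability.** Threads take atomic steps over shared memory, each following its state machine; executions are finite interleavings of such steps from the initial state. The history of an execution is its subsequence of invoke and response steps. A linearisation of an execution $\sigma$ with respect to a set $\mathit{Spec}$ of sequential histories is an $H\in\mathit{Spec}$ such that, after adding responses to some pending invocations of $\sigma$ and removing the others, $H$ and $\sigma$ consist of the same invocations and responses, and $H$ preserves the order of non-overlapping operations of $\sigma$. An algorithm is *strongly linearisable* with respect to $\mathit{Spec}$ if there is a function $f$ that maps each execution $\sigma$ to a linearisation of $\sigma$ and is prefix preserving: if $\sigma$ is a prefix of $\sigma'$, then $f(\sigma)$ is a prefix of $f(\sigma')$. **Relaxation.** A sequential history $H$ is an $r$-relaxation of a sequential history $H'$ if $H$ consists of all but at most $r$ invocations of $H'$ with their responses, and each invocation in $H$ is preceded in $H$ by all but at most $r$ of the invocations that precede it in $H'$. For a set $\mathit{Spec}$ of sequential histories, $\mathit{Spec}^r=\{H' : \text{some } H\in \mathit{Spec} \text{ is an } r\text{-relaxation of } H'\}$. **Composable sketches.** A derandomised sketch (all random choices are fixed by an oracle: those made at initialisation are part of the empty state, and coins supplied with an update are part of its argument) has an empty state and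 deterministic methods $\mathrm{update}(a)$ and $\mathrm{query}(x)$. $\mathit{SeqSketch}$ is the set of its sequential histories of updates and queries, started from the empty state. A state *summarises* the stream $a_1,\dots,a_n$ if it is the state reached from the empty state by $\mathrm{update}(a_1),\dots,\mathrm{update}(a_n)$. The sketch is *composable* if moreover it has the following. - A method $\mathrm{merge}$: if $s$ summarises $A$ and $s'$ summarises $A'$, then $s.\mathrm{merge}(s')$ summarises $A\|A'$. - A method $\mathrm{calcHint}$ that returns a hint $\ne 0$ on every state that summarises a stream, and a static predicate $\mathrm{shouldAdd}$ such that if $s$ summarises $A$ and $\mathrm{shouldAdd}(s.\mathrm{calcHint}(),a)$ is false, then for all streams $B_1,B_2$, every state that summarises $A\|B_1\|a\|B_2$ also summarises $A\|B_1\|B_2$. The initial hint $1\neq 0$ has this property for the empty stream $A$: if $\mathrm{shouldAdd}(1,a)$ is false, then every state that summarises $B_1\|a\|B_2$ also summarises $B_1\|B_2$. - A method $\mathrm{snapshot}$ that returns a copy which answers every query as the sketch does at that moment. - A concurrent implementation of a shared, initially empty sketch (each operation may take many steps) that is strongly linearisable with respect to the sequential behaviour of $\mathrm{merge}$, $\mathrm{calcHint}$,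 $\mathrm{snapshot}$ in all executions in which one thread invokes merges (with arguments that summarise some stream) and $\mathrm{calcHint}$, and other threads invoke snapshots. **The algorithm $\mathit{OptParSketch}$**, with update threads $t_1,\dots,t_N$, a propagator thread, an arbitrary set of query threads, and buffer size $b\ge 1$. The shared sketch is $\mathit{globalS}$, initially empty. For each $i$ there are sketches $\mathit{localS}_i[0],\mathit{localS}_i[1]$, initially empty, $\mathit{cur}_i=0$, $\mathit{counter}_i=0$, $\mathit{hint}_i=1$, and an atomic variable $\mathit{prop}_i=1$. - $\mathrm{update}_i(a)$, by $t_i$: if $\mathrm{shouldAdd}(\mathit{hint}_i,a)$ is false, return. Otherwise $\mathit{counter}_i\leftarrow\mathit{counter}_i+1$; $\mathit{localS}_i[\mathit{cur}_i].\mathrm{update}(a)$; and if now $\mathit{counter}_i=b$: wait until $\mathit{prop}_i\ne0$; $\mathit{cur}_i\leftarrow1-\mathit{cur}_i$; $\mathit{hint}_i\leftarrow\mathit{prop}_i$; $\mathit{counter}_i\leftarrow0$; $\mathit{prop}_i\leftarrow0$. Return. - Propagator, forever: for an $i$ with $\mathit{prop}_i=0$: $\mathit{globalS}.\mathrm{merge}(\mathit{localS}_i[1-\mathit{cur}_i])$;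 $\mathit{localS}_i[1-\mathit{cur}_i]\leftarrow$ empty sketch; $\mathit{prop}_i\leftarrow\mathit{globalS}.\mathrm{calcHint}()$. - $\mathrm{query}(x)$, by a query thread: $\mathit{localCopy}\leftarrow\mathit{globalS}.\mathrm{snapshot}()$; return $\mathit{localCopy}.\mathrm{query}(x)$. **Theorem.** For all $N$ and all $b\ge1$, $\mathit{OptParSketch}$ instantiated with a composable sketch with sequential specification $\mathit{SeqSketch}$ is strongly linearisable with respect to $\mathit{SeqSketch}^{2Nb}$. -/

import Mathlib

/-! ## Threads, steps, executions, histories -/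

/-- What a step of a thread does: it invokes an operation, it responds to the thread's pending
operation, or it is internal. -/
inductive StepAction (I R : Type*) where
  | inv (i : I)
  | res (r : R)
  | tau

/-- An algorithm run by threads `T` that implements an object with invocations `I` and responses
`R`: `Step s t α s'` says that in global state `s` thread `t` can take a step with action `α`,
leading to global state `s'`. -/
structure Algorithm (T I R : Type*) where
  State : Type*
  init : State
  Step : State → T → StepAction I R → State → Prop

namespace Algorithm

variable {T I R : Type*}

/-- A step of an execution, with the state it leads to. -/
abbrev ExecStep (A : Algorithm T I R) : Type _ := T × StepAction I R × A.State

def IsPath (A : Algorithm T I R) : A.State → List A.ExecStep → Prop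
  | _, [] => True
  | s, (t, α, s') :: σ => A.Step s t α s' ∧ A.IsPath s' σ

/-- A finite execution: an alternating sequence of states and steps that starts in the initial
state (which is not recorded). -/
def IsExecution (A : Algorithm T I R) (σ : List A.ExecStep) : Prop :=
  A.IsPath A.init σ

end Algorithm

/-- An element of a history: an invoke or a response step of a thread. -/
inductive Event (T I R : Type*) where
  | inv (t : T) (i : I)
  | res (t : T) (r : R)

def Event.thread {T I R : Type*} : Event T I R → T
  | .inv t _ => t
  | .res t _ => t

def StepAction.event? {T I R : Type*} (t : T) : StepAction I R → Option (Event T I R)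
  | .inv i => some (.inv t i)
  | .res r => some (.res t r)
  | .tau => none

/-- The history of an execution: its subsequence of invoke and response steps. -/
def Algorithm.history {T I R : Type*} (A : Algorithm T I R) (σ : List A.ExecStep) :
    List (Event T I R) :=
  σ.filterMap fun e => e.2.1.event? e.1

/-- An invocation together with its response, by thread `thread`. The number `id` tells different
calls apart; in a linearisation of a history `h` it is the position in `h` of the invocation. -/
structure Call (T I R : Type*) where
  id : ℕ
  thread : T
  inv : I
  res : R

/-- A sequential history: each invocation is immediately followed by its response, so that it is
a list of calls. -/
abbrev SeqHistory (T I R : Type*) : Type _ := List (Call T I R)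

/-- In the history `h`, the operation invoked by thread `t` at position `p` gets its response `r`
at position `q`. -/
def RespondsAt {T I R : Type*} (h : List (Event T I R)) (p q : ℕ) (t : T) (r : R) : Prop :=
  (∃ i, h[p]? = some (.inv t i)) ∧ h[q]? = some (.res t r) ∧ p < q ∧
    ∀ m e, p < m → m < q → h[m]? = some e → e.thread ≠ t

/-- In the history `h`, the operation invoked at position `p` gets its response before the
invocation at position `p'`. -/
def PrecedesInTime {T I R : Type*} (h : List (Event T I R)) (p p' : ℕ) : Prop :=
  ∃ q t r, RespondsAt h p q t r ∧ q < p'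

/-- `H` arises from the concurrent history `h` by adding responses to some pending invocations,
removing the other pending invocations, and ordering the resulting calls sequentially in a way
that preserves the order between non-overlapping operations. -/
structure IsSerialisation {T I R : Type*} (h : List (Event T I R)) (H : SeqHistory T I R) :
    Prop where
  nodup : (H.map Call.id).Nodup
  invoked : ∀ c ∈ H, h[c.id]? = some (.inv c.thread c.inv)
  completed : ∀ p q t r, RespondsAt h p q t r → ∃ c ∈ H, c.id = p ∧ c.res = r
  order : H.Pairwise fun c c' => ¬ PrecedesInTime h c'.id c.id

/-- Strong linearisability with respect to a set of sequential histories: there is a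
prefix-preserving function that maps every execution to one of its linearisations. -/
def StronglyLinearisable {T I R : Type*} (A : Algorithm T I R) (Spec : Set (SeqHistory T I R)) :
    Prop :=
  ∃ f : List A.ExecStep → SeqHistory T I R,
    (∀ σ σ', A.IsExecution σ → A.IsExecution σ' → σ <+: σ' → f σ <+: f σ') ∧
    ∀ σ, A.IsExecution σ → f σ ∈ Spec ∧ IsSerialisation (A.history σ) (f σ)

/-! ## Relaxation -/

/-- `H` is an `r`-relaxation of `H'`: it consists of all but at most `r` of the calls of `H'` (`φ`
sends each call of `H` to the same call in `H'`), and each call of `H` is preceded in `H` by all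
but at most `r` of the calls that precede it in `H'`. -/
def IsRelaxation {T I R : Type*} (r : ℕ) (H H' : SeqHistory T I R) : Prop :=
  ∃ φ : Fin H.length → Fin H'.length, Function.Injective φ ∧
    (∀ k, H[k] = H'[φ k]) ∧
    H'.length ≤ H.length + r ∧
    ∀ k, {j : Fin H'.length | j < φ k ∧ ∀ i, i < k → φ i ≠ j}.ncard ≤ r

/-- The `r`-relaxation of a sequential specification. -/
def Relaxed {T I R : Type*} (Spec : Set (SeqHistory T I R)) (r : ℕ) : Set (SeqHistory T I R) :=
  {H' | ∃ H ∈ Spec, IsRelaxation r H H'}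

/-! ## Sequential sketches -/

/-- The sequential methods of a (derandomised) sketch with stream elements `Elem`, query
arguments `Arg`, query results `Val` and hints `Hint`. The oracle's output is fixed: a random
choice made at initialisation is part of `empty`, and a coin flip supplied with an update is part
of the element. -/
structure SketchMethods (Elem Arg Val Hint : Type*) where
  State : Type*
  empty : State
  update : State → Elem → State
  query : State → Arg → Val
  merge : State → State → State
  calcHint : State → Hint
  shouldAdd : Hint → Elem → Bool

/-- The state `s` summarises the stream `A`: it is the state of a sketch that has processed `A`. -/
def SketchMethods.Summarises {Elem Arg Val Hint : Type*} (S : SketchMethods Elem Arg Val Hint)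
    (s : S.State) (A : List Elem) : Prop :=
  s = A.foldl S.update S.empty

inductive SketchInv (Elem Arg : Type*) where
  | update (a : Elem)
  | query (x : Arg)

inductive SketchRes (Val : Type*) where
  | ack
  | value (v : Val)

/-- The sequential history is the one of a sequential execution from state `s`. -/
def SketchMethods.SeqRun {Elem Arg Val Hint : Type*} (S : SketchMethods Elem Arg Val Hint)
    {T : Type*} : S.State → SeqHistory T (SketchInv Elem Arg) (SketchRes Val) → Prop
  | _, [] => True
  | s, c :: H =>
    match c.inv with
    | .update a => c.res = .ack ∧ S.SeqRun (S.update s a) H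
    | .query x => c.res = .value (S.query s x) ∧ S.SeqRun s H

/-- The histories of updates and queries that arise in sequential executions of the sketch. -/
def SeqSketch {Elem Arg Val Hint : Type*} (S : SketchMethods Elem Arg Val Hint) (T : Type*) :
    Set (SeqHistory T (SketchInv Elem Arg) (SketchRes Val)) :=
  {H | S.SeqRun S.empty H}

/-! ## Composable sketches -/

/-- An implementation of a shared object in which every thread runs a deterministic state machine
(with local states `Loc`) over a shared memory `Mem`: `start t i` is the local state of thread `t`
right after it invokes `i`, and each later step transforms the memory atomically and either moves
to a new local state or ends the operation with a response. -/
structure SharedObject.{w, u, v, x} (T : Type u) (I : Type v) (R : Type x) where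
  Mem : Type w
  Loc : Type w
  mem : Mem
  start : T → I → Loc
  next : T → Mem → Loc → Mem × (Loc ⊕ R)

namespace SharedObject

variable {T I R : Type*} [DecidableEq T]

/-- The shared memory, and for each thread the local state of its operation in progress. -/
abbrev Config (O : SharedObject T I R) : Type _ := O.Mem × (T → Option O.Loc)

inductive Step (O : SharedObject T I R) (allowed : T → I → Prop) :
    O.Config → T → StepAction I R → O.Config → Prop
  | invoke (m : O.Mem) (p : T → Option O.Loc) (t : T) (i : I) :
      allowed t i → p t = none →
      Step O allowed (m, p) t (.inv i) (m, Function.update p t (some (O.start t i)))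
  | internal (m m' : O.Mem) (p : T → Option O.Loc) (t : T) (l l' : O.Loc) :
      p t = some l → O.next t m l = (m', Sum.inl l') →
      Step O allowed (m, p) t .tau (m', Function.update p t (some l'))
  | respond (m m' : O.Mem) (p : T → Option O.Loc) (t : T) (l : O.Loc) (r : R) :
      p t = some l → O.next t m l = (m', Sum.inr r) →
      Step O allowed (m, p) t (.res r) (m', Function.update p t none)

/-- The executions of the object in which thread `t` invokes only operations `i` with
`allowed t i`, one at a time. -/
def toAlgorithm (O : SharedObject T I R) (allowed : T → I → Prop) : Algorithm T I R where
  State := O.Config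
  init := (O.mem, fun _ => none)
  Step := O.Step allowed

end SharedObject

/-- The threads that access the global sketch: the propagator and the query threads `Q`. -/
inductive GlobalThread (Q : Type*) where
  | propagator
  | query (j : Q)
deriving DecidableEq

inductive GlobalInv (σ : Type*) where
  | merge (s : σ)
  | calcHint
  | snapshot

inductive GlobalRes (σ Hint : Type*) where
  | ack
  | hint (h : Hint)
  | copy (s : σ)

/-- Sequential specification of `merge`, `calcHint` and `snapshot`, from state `s`; a snapshot may
return any copy that answers all queries as the current state does. -/
def SketchMethods.GlobalRun {Elem Arg Val Hint : Type*} (S : SketchMethods Elem Arg Val Hint)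
    {T : Type*} : S.State → SeqHistory T (GlobalInv S.State) (GlobalRes S.State Hint) → Prop
  | _, [] => True
  | s, c :: H =>
    match c.inv with
    | .merge s' => c.res = .ack ∧ S.GlobalRun (S.merge s s') H
    | .calcHint => c.res = .hint (S.calcHint s) ∧ S.GlobalRun s H
    | .snapshot =>
        (∃ s', c.res = .copy s' ∧ ∀ x, S.query s' x = S.query s x) ∧ S.GlobalRun s H

/-- The concurrency that a composable sketch has to support: one thread, the propagator, merges
sketches into the shared one and computes hints, while other threads take snapshots. -/
def SketchMethods.GlobalAllowed {Elem Arg Val Hint : Type*} (S : SketchMethods Elem Arg Val Hint)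
    {Q : Type*} : GlobalThread Q → GlobalInv S.State → Prop
  | .propagator, .merge s => ∃ A, S.Summarises s A
  | .propagator, .calcHint => True
  | .query _, .snapshot => True
  | _, _ => False

/-- A composable sketch, shared with a set `Q` of query threads. -/
structure ComposableSketch.{w, y, u₁, u₂, u₃, u₄, u₅} (Elem : Type u₁) (Arg : Type u₂)
    (Val : Type u₃) (Hint : Type u₄) (Q : Type u₅) [Zero Hint] [One Hint] [DecidableEq Q]
    extends SketchMethods.{u₁, u₂, u₃, u₄, y} Elem Arg Val Hint where
  merge_summarises : ∀ s s' A A', toSketchMethods.Summarises s A →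
    toSketchMethods.Summarises s' A' → toSketchMethods.Summarises (merge s s') (A ++ A')
  calcHint_ne_zero : ∀ s A, toSketchMethods.Summarises s A → calcHint s ≠ 0
  shouldAdd_calcHint : ∀ s A a, toSketchMethods.Summarises s A →
    shouldAdd (calcHint s) a = false → ∀ B₁ B₂ s',
    toSketchMethods.Summarises s' (A ++ B₁ ++ [a] ++ B₂) →
    toSketchMethods.Summarises s' (A ++ B₁ ++ B₂)
  /-- The initial hint `1` of the update threads is a correct hint for the empty sketch. -/
  shouldAdd_one : ∀ a, shouldAdd 1 a = false → ∀ B₁ B₂ s',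
    toSketchMethods.Summarises s' (B₁ ++ [a] ++ B₂) → toSketchMethods.Summarises s' (B₁ ++ B₂)
  /-- The implementation of the shared sketch, initially empty. -/
  shared : SharedObject.{w} (GlobalThread Q) (GlobalInv State) (GlobalRes State Hint)
  shared_stronglyLinearisable :
    StronglyLinearisable (shared.toAlgorithm toSketchMethods.GlobalAllowed)
      {H | toSketchMethods.GlobalRun empty H}

/-! ## The double-buffered concurrent algorithm -/

/-- `N` update threads, the propagator, and the query threads. -/
inductive OptThread (N : ℕ) (Q : Type*) where
  | update (i : Fin N)
  | propagator
  | query (j : Q)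

/-- Program counter of an update thread: the statement it executes next. -/
inductive UpdatePC (Elem : Type*) where
  | idle
  | shouldAdd (a : Elem)
  | incCounter (a : Elem)
  | updateLocal (a : Elem)
  | checkFull
  | wait
  | swap
  | updateHint
  | zeroCounter
  | signal
  | respond

/-- Program counter of the propagator; `merging` and `calculating` mean that the call of `merge`
or `calcHint` on the global sketch is in progress. -/
inductive PropagatorPC (N : ℕ) (Hint : Type*) where
  | scan
  | merge (i : Fin N)
  | merging (i : Fin N)
  | emptyLocal (i : Fin N)
  | calcHint (i : Fin N)
  | calculating (i : Fin N)
  | setProp (i : Fin N) (h : Hint)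

/-- Program counter of a query thread. -/
inductive QueryPC (Arg σ : Type*) where
  | idle
  | snapshot (x : Arg)
  | snapshotting (x : Arg)
  | respond (x : Arg) (localCopy : σ)

section OptParSketch

variable {Elem Arg Val Hint Q : Type*} [Zero Hint] [One Hint] [DecidableEq Q]

/-- The two local sketches of thread `i` are `localS i false` and `localS i true`, the one that
it currently works on is `localS i (cur i)`, and the auxiliary one is `localS i (!cur i)`. -/
structure OptState (S : ComposableSketch Elem Arg Val Hint Q) (N : ℕ) where
  globalS : S.shared.Config
  localS : Fin N → Bool → S.State
  cur : Fin N → Bool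
  counter : Fin N → ℕ
  hint : Fin N → Hint
  prop : Fin N → Hint
  updatePC : Fin N → UpdatePC Elem
  propagatorPC : PropagatorPC N Hint
  queryPC : Q → QueryPC Arg S.State

def OptState.init (S : ComposableSketch Elem Arg Val Hint Q) (N : ℕ) : OptState S N where
  globalS := (S.shared.mem, fun _ => none)
  localS := fun _ _ => S.empty
  cur := fun _ => false
  counter := fun _ => 0
  hint := fun _ => 1
  prop := fun _ => 1
  updatePC := fun _ => .idle
  propagatorPC := .scan
  queryPC := fun _ => .idle

/-- Set the program counter of update thread `i`. -/
def OptState.gotoU {S : ComposableSketch Elem Arg Val Hint Q} {N : ℕ} (s : OptState S N)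
    (i : Fin N) (pc : UpdatePC Elem) : OptState S N :=
  { s with updatePC := Function.update s.updatePC i pc }

/-- Set the program counter of query thread `j`. -/
def OptState.gotoQ {S : ComposableSketch Elem Arg Val Hint Q} {N : ℕ} (s : OptState S N)
    (j : Q) (pc : QueryPC Arg S.State) : OptState S N :=
  { s with queryPC := Function.update s.queryPC j pc }

/-- Assign to one of the two local sketches of update thread `i`. -/
def OptState.setLocal {S : ComposableSketch Elem Arg Val Hint Q} {N : ℕ} (s : OptState S N)
    (i : Fin N) (k : Bool) (x : S.State) : OptState S N :=
  { s with localS := Function.update s.localS i (Function.update (s.localS i) k x) }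

/-- One step of the implementation of the global sketch. -/
abbrev ComposableSketch.SharedStep (S : ComposableSketch Elem Arg Val Hint Q)
    (g : S.shared.Config) (t : GlobalThread Q)
    (α : StepAction (GlobalInv S.State) (GlobalRes S.State Hint)) (g' : S.shared.Config) : Prop :=
  S.shared.Step (fun _ _ => True) g t α g'

/-- The steps of the double-buffered algorithm with buffer size `b`. -/
inductive OptStep (S : ComposableSketch Elem Arg Val Hint Q) (N b : ℕ) :
    OptState S N → OptThread N Q → StepAction (SketchInv Elem Arg) (SketchRes Val) →
    OptState S N → Prop
  -- update threads
  | u_invoke (s : OptState S N) (i : Fin N) (a : Elem) : s.updatePC i = .idle →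
      OptStep S N b s (.update i) (.inv (.update a)) (s.gotoU i (.shouldAdd a))
  | u_filter (s : OptState S N) (i : Fin N) (a : Elem) : s.updatePC i = .shouldAdd a →
      S.shouldAdd (s.hint i) a = false →
      OptStep S N b s (.update i) .tau (s.gotoU i .respond)
  | u_add (s : OptState S N) (i : Fin N) (a : Elem) : s.updatePC i = .shouldAdd a →
      S.shouldAdd (s.hint i) a = true →
      OptStep S N b s (.update i) .tau (s.gotoU i (.incCounter a))
  | u_incCounter (s : OptState S N) (i : Fin N) (a : Elem) : s.updatePC i = .incCounter a →
      OptStep S N b s (.update i) .tau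
        ({ s with counter := Function.update s.counter i (s.counter i + 1) }.gotoU i
          (.updateLocal a))
  | u_updateLocal (s : OptState S N) (i : Fin N) (a : Elem) : s.updatePC i = .updateLocal a →
      OptStep S N b s (.update i) .tau
        ((s.setLocal i (s.cur i) (S.update (s.localS i (s.cur i)) a)).gotoU i .checkFull)
  | u_notFull (s : OptState S N) (i : Fin N) : s.updatePC i = .checkFull → s.counter i ≠ b →
      OptStep S N b s (.update i) .tau (s.gotoU i .respond)
  | u_full (s : OptState S N) (i : Fin N) : s.updatePC i = .checkFull → s.counter i = b →
      OptStep S N b s (.update i) .tau (s.gotoU i .wait)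
  | u_wait (s : OptState S N) (i : Fin N) : s.updatePC i = .wait → s.prop i ≠ 0 →
      OptStep S N b s (.update i) .tau (s.gotoU i .swap)
  | u_swap (s : OptState S N) (i : Fin N) : s.updatePC i = .swap →
      OptStep S N b s (.update i) .tau
        ({ s with cur := Function.update s.cur i (!s.cur i) }.gotoU i .updateHint)
  | u_updateHint (s : OptState S N) (i : Fin N) : s.updatePC i = .updateHint →
      OptStep S N b s (.update i) .tau
        ({ s with hint := Function.update s.hint i (s.prop i) }.gotoU i .zeroCounter)
  | u_zeroCounter (s : OptState S N) (i : Fin N) : s.updatePC i = .zeroCounter →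
      OptStep S N b s (.update i) .tau
        ({ s with counter := Function.update s.counter i 0 }.gotoU i .signal)
  | u_signal (s : OptState S N) (i : Fin N) : s.updatePC i = .signal →
      OptStep S N b s (.update i) .tau
        ({ s with prop := Function.update s.prop i 0 }.gotoU i .respond)
  | u_respond (s : OptState S N) (i : Fin N) : s.updatePC i = .respond →
      OptStep S N b s (.update i) (.res .ack) (s.gotoU i .idle)
  -- propagator
  | p_select (s : OptState S N) (i : Fin N) : s.propagatorPC = .scan → s.prop i = 0 →
      OptStep S N b s .propagator .tau { s with propagatorPC := .merge i }
  | p_merge (s : OptState S N) (i : Fin N) (g : S.shared.Config) : s.propagatorPC = .merge i →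
      S.SharedStep s.globalS .propagator (.inv (.merge (s.localS i (!s.cur i)))) g →
      OptStep S N b s .propagator .tau { s with globalS := g, propagatorPC := .merging i }
  | p_merging (s : OptState S N) (i : Fin N) (g : S.shared.Config) :
      s.propagatorPC = .merging i → S.SharedStep s.globalS .propagator .tau g →
      OptStep S N b s .propagator .tau { s with globalS := g }
  | p_merged (s : OptState S N) (i : Fin N) (g : S.shared.Config)
      (r : GlobalRes S.State Hint) :
      s.propagatorPC = .merging i → S.SharedStep s.globalS .propagator (.res r) g →
      OptStep S N b s .propagator .tau { s with globalS := g, propagatorPC := .emptyLocal i }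
  | p_emptyLocal (s : OptState S N) (i : Fin N) : s.propagatorPC = .emptyLocal i →
      OptStep S N b s .propagator .tau
        { s.setLocal i (!s.cur i) S.empty with propagatorPC := .calcHint i }
  | p_calcHint (s : OptState S N) (i : Fin N) (g : S.shared.Config) :
      s.propagatorPC = .calcHint i → S.SharedStep s.globalS .propagator (.inv .calcHint) g →
      OptStep S N b s .propagator .tau { s with globalS := g, propagatorPC := .calculating i }
  | p_calculating (s : OptState S N) (i : Fin N) (g : S.shared.Config) :
      s.propagatorPC = .calculating i → S.SharedStep s.globalS .propagator .tau g →
      OptStep S N b s .propagator .tau { s with globalS := g }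
  | p_calculated (s : OptState S N) (i : Fin N) (g : S.shared.Config) (h : Hint) :
      s.propagatorPC = .calculating i → S.SharedStep s.globalS .propagator (.res (.hint h)) g →
      OptStep S N b s .propagator .tau { s with globalS := g, propagatorPC := .setProp i h }
  | p_setProp (s : OptState S N) (i : Fin N) (h : Hint) : s.propagatorPC = .setProp i h →
      OptStep S N b s .propagator .tau
        { s with prop := Function.update s.prop i h, propagatorPC := .scan }
  -- query threads
  | q_invoke (s : OptState S N) (j : Q) (x : Arg) : s.queryPC j = .idle →
      OptStep S N b s (.query j) (.inv (.query x)) (s.gotoQ j (.snapshot x))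
  | q_snapshot (s : OptState S N) (j : Q) (x : Arg) (g : S.shared.Config) :
      s.queryPC j = .snapshot x → S.SharedStep s.globalS (.query j) (.inv .snapshot) g →
      OptStep S N b s (.query j) .tau ({ s with globalS := g }.gotoQ j (.snapshotting x))
  | q_snapshotting (s : OptState S N) (j : Q) (x : Arg) (g : S.shared.Config) :
      s.queryPC j = .snapshotting x → S.SharedStep s.globalS (.query j) .tau g →
      OptStep S N b s (.query j) .tau { s with globalS := g }
  | q_copied (s : OptState S N) (j : Q) (x : Arg) (g : S.shared.Config) (localCopy : S.State) :
      s.queryPC j = .snapshotting x →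
      S.SharedStep s.globalS (.query j) (.res (.copy localCopy)) g →
      OptStep S N b s (.query j) .tau ({ s with globalS := g }.gotoQ j (.respond x localCopy))
  | q_respond (s : OptState S N) (j : Q) (x : Arg) (localCopy : S.State) :
      s.queryPC j = .respond x localCopy →
      OptStep S N b s (.query j) (.res (.value (S.query localCopy x))) (s.gotoQ j .idle)

/-- The double-buffered generic concurrent sketch algorithm with `N` update threads and buffer
size `b`, instantiated with the composable sketch `S`. -/
def OptParSketch (S : ComposableSketch Elem Arg Val Hint Q) (N b : ℕ) :
    Algorithm (OptThread N Q) (SketchInv Elem Arg) (SketchRes Val) where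
  State := OptState S N
  init := OptState.init S N
  Step := OptStep S N b

end OptParSketch

/-! Two sequential histories are carried along an execution. `H`, the linearisation, lists calls in
the order in which they take effect; `V` lists the calls that queries can already see, in the order
in which they become visible. `V` is a genuine sequential history of the sketch, the global sketch
always summarises its stream, and `H` differs from it by the buffered updates.

A filtered update takes effect when `shouldAdd` fails and is visible at once: its hint was computed
on a prefix of the visible stream, so appending the element does not change the summary. Any other
update enters `H` when it is written to the local sketch, and enters `V` with the rest of its buffer
when the merge of that buffer takes effect. A query enters both when its snapshot takes effect.

Each thread hides at most two buffers of `b` updates, so `H` is never longer than `V` by more than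
`r = 2 * N * b`. Hence a call that becomes visible at position `k` of `V` is among the first `k + r
+ 1` calls of `H` (`Early`), and counting positions turns this into an `r`-relaxation
(`isRelaxation_of_take`).

Merges and snapshots are not atomic. Their moments of effect are read off from the prefix-preserving
linearisation `f` of the shared sketch: each step extends `f` by finitely many calls, which are
replayed one by one on `H` and `V` (`SimInv.absorb`). Prefix preservation is indispensable, since
`H` may only be extended. `stronglyLinearisable_of_simulation` turns the resulting step-by-step
invariant `FullInv` into a linearisation function. -/

/-! ## Executions, step by step -/

namespace Algorithm

variable {T I R : Type*}

/-- The state reached by a path from `s`. -/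
def endState (A : Algorithm T I R) : A.State → List A.ExecStep → A.State
  | s, [] => s
  | _, (_, _, s') :: σ => A.endState s' σ

theorem isPath_concat (A : Algorithm T I R) (s : A.State) (σ : List A.ExecStep) (t : T)
    (α : StepAction I R) (s' : A.State) :
    A.IsPath s (σ ++ [(t, α, s')]) ↔ A.IsPath s σ ∧ A.Step (A.endState s σ) t α s' := by
  induction σ generalizing s with
  | nil => simp [IsPath, endState]
  | cons e σ ih =>
    obtain ⟨t', α', s''⟩ := e
    simp [IsPath, endState, ih, and_assoc]

theorem endState_concat (A : Algorithm T I R) (s : A.State) (σ : List A.ExecStep)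
    (e : A.ExecStep) : A.endState s (σ ++ [e]) = e.2.2 := by
  induction σ generalizing s with
  | nil => rfl
  | cons e' σ ih => simpa [endState] using ih _

theorem history_concat (A : Algorithm T I R) (σ : List A.ExecStep) (e : A.ExecStep) :
    A.history (σ ++ [e]) = A.history σ ++ (e.2.1.event? e.1).toList := by
  rcases h : e.2.1.event? e.1 <;> simp [history, h]

end Algorithm

/-! ## Strong linearisability by simulation -/

section Simulation

variable {T I R : Type*}

open Classical in
/-- Extends the linearisation of an execution, given in reverse, step by step. -/
noncomputable def simulate {E : Type*} (Inv : List E → SeqHistory T I R → Prop)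
    (H₀ : SeqHistory T I R) : List E → SeqHistory T I R
  | [] => H₀
  | e :: ρ =>
    if h : ∃ H', simulate Inv H₀ ρ <+: H' ∧ Inv (e :: ρ).reverse H' then h.choose
    else simulate Inv H₀ ρ

/-- Each step either extends the previous value or keeps it, so prefix preservation needs nothing
about `Inv`. Lists are reversed: the latest step is the head. -/
theorem simulate_prefix {E : Type*} (Inv : List E → SeqHistory T I R → Prop)
    (H₀ : SeqHistory T I R) (κ ρ : List E) :
    simulate Inv H₀ ρ <+: simulate Inv H₀ (κ ++ ρ) := by
  induction κ with
  | nil => exact List.prefix_refl _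
  | cons e κ ih =>
    refine ih.trans ?_
    rw [List.cons_append, simulate]
    split_ifs with h
    · exact h.choose_spec.1
    · exact List.prefix_refl _

/-- A relation between executions and linearisations that can be maintained step by step by only
extending the linearisation proves strong linearisability. -/
theorem stronglyLinearisable_of_simulation (A : Algorithm T I R) (Spec : Set (SeqHistory T I R))
    (Inv : List A.ExecStep → SeqHistory T I R → Prop) (H₀ : SeqHistory T I R) (h₀ : Inv [] H₀)
    (hstep : ∀ σ e H, A.IsExecution (σ ++ [e]) → Inv σ H → ∃ H', H <+: H' ∧ Inv (σ ++ [e]) H')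
    (hsound : ∀ σ H, Inv σ H → H ∈ Spec ∧ IsSerialisation (A.history σ) H) :
    StronglyLinearisable A Spec := by
  -- Along an actual execution an extension always exists, so the fallback branch of `simulate` is
  -- never taken.
  have key : ∀ ρ : List A.ExecStep, A.IsExecution ρ.reverse →
      Inv ρ.reverse (simulate Inv H₀ ρ) := by
    intro ρ
    induction ρ with
    | nil => intro _; exact h₀
    | cons e ρ ih =>
      intro hρ
      have hex := hρ
      rw [List.reverse_cons] at hex
      obtain ⟨H', hpre, hinv⟩ := hstep _ _ _ hex
        (ih ((A.isPath_concat _ _ e.1 e.2.1 e.2.2).1 hex).1)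
      have h : ∃ H', simulate Inv H₀ ρ <+: H' ∧ Inv (e :: ρ).reverse H' :=
        ⟨H', hpre, by rwa [List.reverse_cons]⟩
      rw [simulate, dif_pos h]
      exact h.choose_spec.2
  refine ⟨fun σ => simulate Inv H₀ σ.reverse, ?_, ?_⟩
  · rintro σ _ _ _ ⟨κ, rfl⟩
    simpa using simulate_prefix Inv H₀ κ.reverse σ.reverse
  · intro σ hσ
    apply hsound
    simpa using key σ.reverse (by simpa using hσ)

end Simulation

/-! ## Open operations and linearised operations -/

section Linearisation

variable {T I R : Type*}

/-- The operation invoked at position `p` of the history `h` by thread `t` is pending. -/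
def OpenAt (h : List (Event T I R)) (p : ℕ) (t : T) (i : I) : Prop :=
  h[p]? = some (.inv t i) ∧ ∀ m e, p < m → h[m]? = some e → e.thread ≠ t

/-- What a thread is doing: nothing, an operation invoked at position `p` that has not taken
effect, or one that has taken effect with response `r`. -/
inductive OpStatus (I R : Type*) where
  | idle
  | pending (p : ℕ) (i : I)
  | done (p : ℕ) (i : I) (r : R)

def OpStatus.IsOpen (o : OpStatus I R) (p : ℕ) (i : I) : Prop :=
  o = .pending p i ∨ ∃ r, o = .done p i r

/-- The sequential history `H` linearises the history `h`, and `st` says for each thread whether it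
has an operation in progress and whether that operation is in `H`. -/
structure Linearises (h : List (Event T I R)) (st : T → OpStatus I R) (H : SeqHistory T I R) :
    Prop where
  ser : IsSerialisation h H
  pend : ∀ t p i, st t = .pending p i → OpenAt h p t i ∧ ∀ c ∈ H, c.id ≠ p
  done : ∀ t p i r, st t = .done p i r → OpenAt h p t i ∧ ∃ c ∈ H, c.id = p ∧ c.res = r
  all : ∀ p t i, h[p]? = some (.inv t i) → (∃ q r, RespondsAt h p q t r) ∨ (st t).IsOpen p i

theorem RespondsAt.concat {h : List (Event T I R)} {p q : ℕ} {t : T} {r : R}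
    (hr : RespondsAt h p q t r) (e : Event T I R) : RespondsAt (h ++ [e]) p q t r := by
  obtain ⟨⟨i, hi⟩, hq, hpq, hm⟩ := hr
  have hql : q < h.length := (List.getElem?_eq_some_iff.1 hq).1
  refine ⟨⟨i, ?_⟩, ?_, hpq, fun m e' h1 h2 h3 => hm m e' h1 h2 ?_⟩
  · rwa [List.getElem?_append_left (by omega)]
  · rwa [List.getElem?_append_left hql]
  · rwa [List.getElem?_append_left (by omega)] at h3

theorem RespondsAt.of_concat {h : List (Event T I R)} {p q : ℕ} {t : T} {r : R} {e : Event T I R}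
    (hr : RespondsAt (h ++ [e]) p q t r) (hql : q < h.length) : RespondsAt h p q t r := by
  obtain ⟨⟨i, hi⟩, hq, hpq, hm⟩ := hr
  rw [List.getElem?_append_left (by omega)] at hi hq
  refine ⟨⟨i, hi⟩, hq, hpq, fun m e' h1 h2 h3 => hm m e' h1 h2 ?_⟩
  rwa [List.getElem?_append_left (by omega)]

theorem RespondsAt.lt_length {h : List (Event T I R)} {p q : ℕ} {t : T} {r : R}
    (hr : RespondsAt h p q t r) : q < h.length :=
  (List.getElem?_eq_some_iff.1 hr.2.1).1

theorem OpenAt.lt_length {h : List (Event T I R)} {p : ℕ} {t : T} {i : I}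
    (ho : OpenAt h p t i) : p < h.length :=
  (List.getElem?_eq_some_iff.1 ho.1).1

theorem OpenAt.not_respondsAt {h : List (Event T I R)} {p q : ℕ} {t t' : T} {i : I} {r : R}
    (ho : OpenAt h p t i) : ¬ RespondsAt h p q t' r := by
  rintro ⟨⟨i', hi⟩, hq, hpq, -⟩
  have := ho.1.symm.trans hi
  simp only [Option.some.injEq, Event.inv.injEq] at this
  exact ho.2 q _ hpq hq this.1.symm

theorem OpenAt.concat {h : List (Event T I R)} {p : ℕ} {t : T} {i : I}
    (ho : OpenAt h p t i) {e : Event T I R} (he : e.thread ≠ t) : OpenAt (h ++ [e]) p t i := by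
  refine ⟨by rw [List.getElem?_append_left ho.lt_length, ho.1], fun m e' hm he' => ?_⟩
  rcases lt_or_ge m h.length with hl | hl
  · rw [List.getElem?_append_left hl] at he'
    exact ho.2 m e' hm he'
  · rw [List.getElem?_append_right hl] at he'
    have := List.getElem?_eq_some_iff.1 he'
    obtain ⟨h1, h2⟩ := this
    simp at h2
    rwa [← h2]

theorem openAt_concat_inv (h : List (Event T I R)) (t : T) (i : I) :
    OpenAt (h ++ [.inv t i]) h.length t i := by
  refine ⟨by simp, fun m e hm he => ?_⟩
  have := (List.getElem?_eq_some_iff.1 he).1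
  simp at this
  omega

theorem OpenAt.respondsAt_concat {h : List (Event T I R)} {p : ℕ} {t : T} {i : I}
    (ho : OpenAt h p t i) (r : R) : RespondsAt (h ++ [.res t r]) p h.length t r := by
  refine ⟨⟨i, by rw [List.getElem?_append_left ho.lt_length, ho.1]⟩, by simp, ho.lt_length,
    fun m e h1 h2 h3 => ho.2 m e h1 ?_⟩
  rwa [List.getElem?_append_left h2] at h3

/-- A thread has only one open operation: an earlier invocation would have the one at `p` between
itself and its response, and a later one would be an event of `t` after `p`. -/
theorem OpenAt.eq_of_respondsAt_concat {h : List (Event T I R)} {p p' : ℕ} {t t' : T} {i : I}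
    {r r' : R} (ho : OpenAt h p t i)
    (hr : RespondsAt (h ++ [.res t r]) p' h.length t' r') : p' = p ∧ r' = r := by
  obtain ⟨⟨i', hi⟩, hq, hpq, hm⟩ := hr
  simp only [List.getElem?_concat_length, Option.some.injEq, Event.res.injEq] at hq
  obtain ⟨rfl, rfl⟩ := hq
  refine ⟨?_, rfl⟩
  rw [List.getElem?_append_left hpq] at hi
  rcases lt_trichotomy p' p with hlt | heq | hgt
  · exact absurd rfl (hm p (.inv t i) hlt ho.lt_length
      (by rw [List.getElem?_append_left ho.lt_length, ho.1]))
  · exact heq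
  · exact absurd rfl (ho.2 p' _ hgt hi)

/-- Serialisations stay serialisations when the history grows, as long as operations that get a
response have been serialised with that response. -/
theorem IsSerialisation.concat {h : List (Event T I R)} {H : SeqHistory T I R}
    (hs : IsSerialisation h H) (e : Event T I R)
    (hc : ∀ p t r, RespondsAt (h ++ [e]) p h.length t r → ∃ c ∈ H, c.id = p ∧ c.res = r) :
    IsSerialisation (h ++ [e]) H where
  nodup := hs.nodup
  invoked c hcH := by
    have := hs.invoked c hcH
    rwa [List.getElem?_append_left (List.getElem?_eq_some_iff.1 this).1]
  completed p q t r hr := by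
    have h1 := hr.lt_length
    simp only [List.length_append, List.length_singleton] at h1
    rcases Nat.lt_succ_iff_lt_or_eq.1 h1 with h2 | rfl
    · exact hs.completed p q t r (hr.of_concat h2)
    · exact hc p t r hr
  order := by
    refine hs.order.imp_of_mem ?_
    -- A response at the new last position comes after every invocation in `H`, so it creates no new
    -- order constraint.
    rintro c c' hcH - hn ⟨q, t, r, hr, hq⟩
    have := (List.getElem?_eq_some_iff.1 (hs.invoked c hcH)).1
    exact hn ⟨q, t, r, hr.of_concat (by omega), hq⟩

namespace Linearises

theorem nil (T I R : Type*) : Linearises ([] : List (Event T I R)) (fun _ => .idle) [] where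
  ser := ⟨by simp, by simp, fun p q t r hr => by simpa using hr.lt_length, by simp⟩
  pend := by simp
  done := by simp
  all := by simp

variable {h : List (Event T I R)} {st : T → OpStatus I R} {H : SeqHistory T I R}

/-- A call that can be added to a linearisation belongs to an operation that has not taken
effect. -/
theorem pending_of_invoked (hl : Linearises h st H) {c : Call T I R}
    (hc : h[c.id]? = some (.inv c.thread c.inv)) (hn : ∀ c' ∈ H, c'.id ≠ c.id) :
    st c.thread = .pending c.id c.inv := by
  rcases hl.all _ _ _ hc with ⟨q, r, hr⟩ | ho | ⟨r, hr⟩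
  · obtain ⟨c', hc', h1, -⟩ := hl.ser.completed _ _ _ _ hr
    exact absurd h1 (hn c' hc')
  · exact ho
  · obtain ⟨-, c', hc', h1, -⟩ := hl.done _ _ _ _ hr
    exact absurd h1 (hn c' hc')

/-- An operation that gets its response has taken effect with that response. -/
theorem done_of_respond (hl : Linearises h st H) {t : T} {r : R}
    (hs : IsSerialisation (h ++ [.res t r]) H) {p : ℕ} {i : I} (ho : (st t).IsOpen p i) :
    st t = .done p i r := by
  rcases ho with ho | ⟨r', hr⟩
  · obtain ⟨h1, h2⟩ := hl.pend _ _ _ ho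
    obtain ⟨c, hc, h3, -⟩ := hs.completed _ _ _ _ (h1.respondsAt_concat r)
    exact absurd h3 (h2 c hc)
  · obtain ⟨h1, c', hc', h2, h3⟩ := hl.done _ _ _ _ hr
    obtain ⟨c, hc, h4, h5⟩ := hs.completed _ _ _ _ (h1.respondsAt_concat r)
    obtain rfl := List.inj_on_of_nodup_map hs.nodup hc hc' (h4.trans h2.symm)
    rw [hr, ← h3, h5]

variable [DecidableEq T]

theorem invoke (hl : Linearises h st H) {t : T} (ht : st t = .idle) (i : I) :
    Linearises (h ++ [.inv t i]) (Function.update st t (.pending h.length i)) H where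
  ser := hl.ser.concat _ fun p t' r hr => by simpa using hr.2.1
  pend t' p i' h1 := by
    by_cases htt : t' = t
    · subst htt
      simp only [Function.update_self, OpStatus.pending.injEq] at h1
      obtain ⟨rfl, rfl⟩ := h1
      exact ⟨openAt_concat_inv h t' i,
        fun c hc => (List.getElem?_eq_some_iff.1 (hl.ser.invoked c hc)).1.ne⟩
    · rw [Function.update_of_ne htt] at h1
      exact ⟨(hl.pend t' p i' h1).1.concat (Ne.symm htt), (hl.pend t' p i' h1).2⟩
  done t' p i' r h1 := by
    by_cases htt : t' = t
    · subst htt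
      simp at h1
    · rw [Function.update_of_ne htt] at h1
      exact ⟨(hl.done t' p i' r h1).1.concat (Ne.symm htt), (hl.done t' p i' r h1).2⟩
  all p t' i' h1 := by
    rcases lt_or_ge p h.length with hp | hp
    · rw [List.getElem?_append_left hp] at h1
      rcases hl.all p t' i' h1 with ⟨q, r, hr⟩ | ho
      · exact Or.inl ⟨q, r, hr.concat _⟩
      · have htt : t' ≠ t := by
          rintro rfl
          simp [OpStatus.IsOpen, ht] at ho
        rw [Function.update_of_ne htt]
        exact Or.inr ho
    · have hp' := (List.getElem?_eq_some_iff.1 h1).1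
      simp only [List.length_append, List.length_singleton] at hp'
      obtain rfl : p = h.length := by omega
      simp only [List.getElem?_concat_length, Option.some.injEq, Event.inv.injEq] at h1
      obtain ⟨rfl, rfl⟩ := h1
      exact Or.inr (Or.inl (by simp))

/-- The linearisation point of an operation. Appending at the end respects real time because an open
operation has no response and thus precedes nothing. -/
theorem linearise (hl : Linearises h st H) {t : T} {p : ℕ} {i : I} (ht : st t = .pending p i)
    (r : R) : Linearises h (Function.update st t (.done p i r)) (H ++ [⟨p, t, i, r⟩]) where
  ser :=
    { nodup := by
        rw [List.map_append, List.nodup_append]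
        refine ⟨hl.ser.nodup, by simp, ?_⟩
        intro a ha b hb
        obtain ⟨c, hc, rfl⟩ := List.mem_map.1 ha
        simp only [List.map_cons, List.map_nil, List.mem_singleton] at hb
        subst hb
        exact (hl.pend _ _ _ ht).2 c hc
      invoked := by
        intro c hc
        rcases List.mem_append.1 hc with hc | hc
        · exact hl.ser.invoked c hc
        · simp only [List.mem_singleton] at hc
          subst hc
          exact (hl.pend t p i ht).1.1
      completed := by
        intro p' q t' r' hr
        obtain ⟨c, hc, h1⟩ := hl.ser.completed p' q t' r' hr
        exact ⟨c, List.mem_append_left _ hc, h1⟩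
      order := by
        rw [List.pairwise_append]
        refine ⟨hl.ser.order, by simp, ?_⟩
        rintro c - c' hc' ⟨q, t', r', hr, -⟩
        simp only [List.mem_singleton] at hc'
        subst hc'
        exact (hl.pend t p i ht).1.not_respondsAt hr }
  pend t' p' i' h1 := by
    by_cases htt : t' = t
    · subst htt
      simp at h1
    · rw [Function.update_of_ne htt] at h1
      refine ⟨(hl.pend t' p' i' h1).1, fun c hc => ?_⟩
      rcases List.mem_append.1 hc with hc | hc
      · exact (hl.pend t' p' i' h1).2 c hc
      · simp only [List.mem_singleton] at hc
        subst hc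
        rintro rfl
        have := (hl.pend t p i ht).1.1.symm.trans (hl.pend t' p i' h1).1.1
        simp only [Option.some.injEq, Event.inv.injEq] at this
        exact htt this.1.symm
  done t' p' i' r' h1 := by
    by_cases htt : t' = t
    · subst htt
      simp only [Function.update_self, OpStatus.done.injEq] at h1
      obtain ⟨rfl, rfl, rfl⟩ := h1
      exact ⟨(hl.pend t' _ _ ht).1, _, List.mem_append_right _ (List.mem_singleton_self _),
        rfl, rfl⟩
    · rw [Function.update_of_ne htt] at h1
      obtain ⟨h2, c, hc, h3⟩ := hl.done t' p' i' r' h1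
      exact ⟨h2, c, List.mem_append_left _ hc, h3⟩
  all p' t' i' h1 := by
    refine (hl.all p' t' i' h1).imp_right fun ho => ?_
    by_cases htt : t' = t
    · subst htt
      simp only [OpStatus.IsOpen, ht, OpStatus.pending.injEq, reduceCtorEq, exists_false,
        or_false] at ho
      obtain ⟨rfl, rfl⟩ := ho
      exact Or.inr ⟨r, by simp⟩
    · rwa [Function.update_of_ne htt]

theorem respond (hl : Linearises h st H) {t : T} {p : ℕ} {i : I} {r : R}
    (ht : st t = .done p i r) :
    Linearises (h ++ [.res t r]) (Function.update st t .idle) H where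
  ser := hl.ser.concat _ fun p' t' r' hr => by
    obtain ⟨h1, h2⟩ := (hl.done t p i r ht).1.eq_of_respondsAt_concat hr
    rw [h1, h2]
    exact (hl.done t p i r ht).2
  pend t' p' i' h1 := by
    by_cases htt : t' = t
    · subst htt
      simp at h1
    · rw [Function.update_of_ne htt] at h1
      exact ⟨(hl.pend t' p' i' h1).1.concat (Ne.symm htt), (hl.pend t' p' i' h1).2⟩
  done t' p' i' r' h1 := by
    by_cases htt : t' = t
    · subst htt
      simp at h1
    · rw [Function.update_of_ne htt] at h1
      exact ⟨(hl.done t' p' i' r' h1).1.concat (Ne.symm htt), (hl.done t' p' i' r' h1).2⟩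
  all p' t' i' h1 := by
    have hp' : p' < h.length := by
      by_contra hcon
      have hp' := (List.getElem?_eq_some_iff.1 h1).1
      simp only [List.length_append, List.length_singleton] at hp'
      obtain rfl : p' = h.length := by omega
      simp at h1
    rw [List.getElem?_append_left hp'] at h1
    rcases hl.all p' t' i' h1 with ⟨q, r', hr⟩ | ho
    · exact Or.inl ⟨q, r', hr.concat _⟩
    · by_cases htt : t' = t
      · subst htt
        simp only [OpStatus.IsOpen, ht, reduceCtorEq, OpStatus.done.injEq, false_or] at ho
        obtain ⟨_, rfl, rfl, rfl⟩ := ho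
        exact Or.inl ⟨_, _, (hl.done t' p i r ht).1.respondsAt_concat r⟩
      · rw [Function.update_of_ne htt]
        exact Or.inr ho

end Linearises

end Linearisation

/-! ## Relaxation -/

section Relaxation

variable {T I R : Type*}

/-- If all but `r` calls of `H'` have been moved to `V`, and the call at position `k` of `V` is
among the first `k + r + 1` calls of `H'`, then `V` is an `r`-relaxation of `H'`. -/
theorem isRelaxation_of_take {r : ℕ} {V H' : SeqHistory T I R} (hV : V.Nodup)
    (hlen : H'.length ≤ V.length + r)
    (htake : ∀ k (hk : k < V.length), V[k] ∈ H'.take (k + r + 1)) : IsRelaxation r V H' := by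
  have hex : ∀ k : Fin V.length, ∃ j : Fin H'.length, j.1 ≤ k.1 + r ∧ V[k] = H'[j] := by
    intro k
    obtain ⟨j, hj, h1⟩ := List.mem_take_iff_getElem.1 (htake k.1 k.2)
    exact ⟨⟨j, by omega⟩, by simp; omega, h1.symm⟩
  choose φ hφ hVφ using hex
  have hinj : Function.Injective φ := by
    intro k k' hkk
    have : V[k] = V[k'] := by rw [hVφ, hVφ, hkk]
    exact Fin.ext ((List.Nodup.getElem_inj_iff hV).1 this)
  refine ⟨φ, hinj, hVφ, hlen, fun k => ?_⟩
  -- The positions used by the calls before `k`. There are `k` of them, all below `k + r` because `φ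
  -- i ≤ i + r`. The positions before `φ k` are below `k + r` too, so at most `r` of them are
  -- missed.
  let A : Finset ℕ := (Finset.Iio k).image fun i => (φ i).1
  have hA : A.card = k.1 := by
    refine (Finset.card_image_of_injective _ (Fin.val_injective.comp hinj)).trans ?_
    exact Fin.card_Iio k
  have hAsub : A ⊆ Finset.range (k.1 + r) := by
    intro x hx
    obtain ⟨i, hi, rfl⟩ := Finset.mem_image.1 hx
    have h1 : i < k := Finset.mem_Iio.1 hi
    have h2 := hφ i
    rw [Finset.mem_range]
    have : i.1 < k.1 := h1
    omega
  calc {j : Fin H'.length | j < φ k ∧ ∀ i, i < k → φ i ≠ j}.ncard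
      ≤ ((Finset.range (k.1 + r) \ A : Finset ℕ) : Set ℕ).ncard := by
        refine Set.ncard_le_ncard_of_injOn (fun j => j.1) ?_ Fin.val_injective.injOn
          (Finset.finite_toSet _)
        rintro j ⟨hj, hj'⟩
        have h1 : j.1 < (φ k).1 := hj
        have h2 := hφ k
        simp only [Finset.coe_sdiff, Set.mem_sdiff, Finset.mem_coe, Finset.mem_range]
        refine ⟨by omega, fun hmem => ?_⟩
        obtain ⟨i, hi, hij⟩ := Finset.mem_image.1 hmem
        exact hj' i (Finset.mem_Iio.1 hi) (Fin.ext hij)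
    _ ≤ r := by
        rw [Set.ncard_coe_finset, Finset.card_sdiff_of_subset hAsub, hA]
        simp

end Relaxation

/-! ## Streams of sequential histories -/

section Sketch

variable {Elem Arg Val Hint T : Type*}

/-- The stream processed by the updates of a sequential history. -/
def stream (V : SeqHistory T (SketchInv Elem Arg) (SketchRes Val)) : List Elem :=
  V.filterMap fun c => match c.inv with
    | .update a => some a
    | .query _ => none

theorem stream_append (V W : SeqHistory T (SketchInv Elem Arg) (SketchRes Val)) :
    stream (V ++ W) = stream V ++ stream W :=
  List.filterMap_append

theorem stream_update (p : ℕ) (t : T) (a : Elem) (r : SketchRes Val) :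
    stream ([⟨p, t, .update a, r⟩] : SeqHistory T (SketchInv Elem Arg) (SketchRes Val)) = [a] := rfl

theorem stream_query (p : ℕ) (t : T) (x : Arg) (r : SketchRes Val) :
    stream ([⟨p, t, .query x, r⟩] : SeqHistory T (SketchInv Elem Arg) (SketchRes Val)) = [] := rfl

/-- A call of `update` that has been acknowledged. -/
def Call.IsUpdate (c : Call T (SketchInv Elem Arg) (SketchRes Val)) : Prop :=
  (∃ a, c.inv = .update a) ∧ c.res = .ack

namespace SketchMethods

variable (S : SketchMethods Elem Arg Val Hint)

theorem seqRun_append (s : S.State) (V W : SeqHistory T (SketchInv Elem Arg) (SketchRes Val)) :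
    S.SeqRun s (V ++ W) ↔ S.SeqRun s V ∧ S.SeqRun ((stream V).foldl S.update s) W := by
  induction V generalizing s with
  | nil => simp [SeqRun, stream]
  | cons c V ih =>
    obtain ⟨p, t, i, r⟩ := c
    cases i <;> simp [SeqRun, stream, ih, and_assoc]

/-- An update is acknowledged in every state, so a whole buffer may be appended to a run without
knowing where it starts. -/
theorem seqRun_of_isUpdate (s : S.State) (W : SeqHistory T (SketchInv Elem Arg) (SketchRes Val))
    (hW : ∀ c ∈ W, c.IsUpdate) : S.SeqRun s W := by
  induction W generalizing s with
  | nil => trivial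
  | cons c W ih =>
    obtain ⟨⟨a, h1⟩, h2⟩ := hW c (by simp)
    simp only [SeqRun, h1]
    exact ⟨h2, ih _ fun c hc => hW c (List.mem_cons_of_mem _ hc)⟩

/-- The state of the global sketch after a sequential history. -/
def globalFinal (s : S.State) (L : SeqHistory T (GlobalInv S.State) (GlobalRes S.State Hint)) :
    S.State :=
  L.foldl (fun s c => match c.inv with
    | .merge s' => S.merge s s'
    | _ => s) s

theorem globalFinal_append (s : S.State)
    (L M : SeqHistory T (GlobalInv S.State) (GlobalRes S.State Hint)) :
    S.globalFinal s (L ++ M) = S.globalFinal (S.globalFinal s L) M :=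
  List.foldl_append

theorem globalRun_append (s : S.State)
    (L M : SeqHistory T (GlobalInv S.State) (GlobalRes S.State Hint)) :
    S.GlobalRun s (L ++ M) ↔ S.GlobalRun s L ∧ S.GlobalRun (S.globalFinal s L) M := by
  induction L generalizing s with
  | nil => simp [GlobalRun, globalFinal]
  | cons c L ih =>
    obtain ⟨p, t, i, r⟩ := c
    cases i <;> simp [GlobalRun, globalFinal, ih, and_assoc]

/-- The hint `h` filters out only elements that do not change the summary of a stream that
starts with `A`. -/
def GoodHint [Zero Hint] (A : List Elem) (h : Hint) : Prop :=
  h ≠ 0 ∧ ∀ a, S.shouldAdd h a = false → ∀ B s, S.Summarises s (A ++ B ++ [a]) →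
    S.Summarises s (A ++ B)

/-- The extra stream is absorbed into `B`. This is why an update thread may keep filtering with an
old hint while others extend the global sketch. -/
theorem GoodHint.append [Zero Hint] {S : SketchMethods Elem Arg Val Hint} {A : List Elem}
    {h : Hint} (hg : S.GoodHint A h) (A' : List Elem) : S.GoodHint (A ++ A') h := by
  refine ⟨hg.1, fun a ha B s hs => ?_⟩
  rw [List.append_assoc A A' B] at hs ⊢
  exact hg.2 a ha (A' ++ B) s hs

end SketchMethods

end Sketch

namespace ComposableSketch

variable {Elem Arg Val Hint Q : Type*} [Zero Hint] [One Hint] [DecidableEq Q]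
  (S : ComposableSketch Elem Arg Val Hint Q)

theorem goodHint_one [NeZero (1 : Hint)] (A : List Elem) : S.GoodHint A 1 := by
  refine ⟨one_ne_zero, fun a ha B s hs => ?_⟩
  -- Here `B₂` is empty: a filtered update becomes visible at once, at the end of the current
  -- stream.
  simpa using S.shouldAdd_one a ha (A ++ B) [] s (by simpa using hs)

theorem goodHint_calcHint {s : S.State} {A : List Elem} (hs : S.Summarises s A) :
    S.GoodHint A (S.calcHint s) := by
  refine ⟨S.calcHint_ne_zero s A hs, fun a ha B s' hs' => ?_⟩
  simpa using S.shouldAdd_calcHint s A a hs ha B [] s' (by simpa using hs')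

end ComposableSketch

/-! ## Calls that become visible early -/

section Early

variable {T I R : Type*}

/-- The call at position `k` of `V` is among the first `k + r + 1` calls of `H`. -/
def Early (r : ℕ) (H V : SeqHistory T I R) : Prop :=
  ∀ k (hk : k < V.length), V[k] ∈ H.take (k + r + 1)

theorem Early.append_left {r : ℕ} {H V : SeqHistory T I R} (he : Early r H V)
    (W : SeqHistory T I R) : Early r (H ++ W) V := fun k hk =>
  ((List.prefix_append H W).take (k + r + 1)).subset (he k hk)

/-- The new calls sit at positions `k ≥ V.length`, where `H.take (k + r + 1)` is all of `H`. The
extra `1` leaves room for a call that enters `H` and `V` in the same step. -/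
theorem Early.append_right {r : ℕ} {H V W : SeqHistory T I R} (he : Early r H V)
    (hlen : H.length ≤ V.length + r + 1) (hW : ∀ c ∈ W, c ∈ H) : Early r H (V ++ W) := by
  intro k hk
  rcases lt_or_ge k V.length with h | h
  · rw [List.getElem_append_left h]
    exact he k h
  · rw [List.getElem_append_right h, List.take_of_length_le (by omega)]
    exact hW _ (List.getElem_mem _)

end Early

/-! ## The simulation invariant -/

section Invariant

variable {Elem Arg Val Hint Q : Type*} {N : ℕ}

noncomputable instance : DecidableEq (OptThread N Q) := Classical.decEq _

/-- The update thread whose auxiliary sketch the propagator is handling. -/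
def PropagatorPC.target : PropagatorPC N Hint → Option (Fin N)
  | .scan => none
  | .merge i | .merging i | .emptyLocal i | .calcHint i | .calculating i | .setProp i _ => some i

/-- What the program counter of an update thread says about its operation. -/
def OpInv (o : OpStatus (SketchInv Elem Arg) (SketchRes Val)) : UpdatePC Elem → Prop
  | .idle => o = .idle
  | .shouldAdd a | .incCounter a | .updateLocal a => ∃ p, o = .pending p (.update a)
  | _ => ∃ p a, o = .done p (.update a) .ack

/-- The number `n` of elements in the current buffer of an update thread. -/
def CountInv (b counter n : ℕ) : UpdatePC Elem → Prop
  | .idle | .shouldAdd _ | .incCounter _ | .respond => counter = n ∧ n < b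
  | .updateLocal _ => counter = n + 1 ∧ n < b
  | .checkFull => counter = n ∧ n ≤ b
  | .wait | .swap => n = b
  | .updateHint | .zeroCounter => n = 0
  | .signal => counter = 0 ∧ n = 0

theorem CountInv.le {b counter n : ℕ} {pc : UpdatePC Elem} (h : CountInv b counter n pc) :
    n ≤ b := by
  cases pc <;> simp only [CountInv] at h <;> omega

variable (S : SketchMethods Elem Arg Val Hint)

/-- The auxiliary sketch `aux` of update thread `i` while it is handed over to the propagator; `A`
is the part of its stream that is not yet in the global sketch. -/
def Handed (i : Fin N) (aux : S.State) (gp : OpStatus (GlobalInv S.State) (GlobalRes S.State Hint))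
    (A : List Elem) : PropagatorPC N Hint → Prop
  | .scan | .merge _ => S.Summarises aux A
  | .merging k => if k = i then ∃ p s, (gp = .pending p (.merge s) ∧ S.Summarises s A) ∨
      ∃ r, gp = .done p (.merge s) r ∧ A = [] else S.Summarises aux A
  | .emptyLocal k => if k = i then A = [] else S.Summarises aux A
  | .calcHint k | .calculating k | .setProp k _ =>
      if k = i then A = [] ∧ aux = S.empty else S.Summarises aux A

/-- The auxiliary sketch `aux` of update thread `i`. -/
def AuxInv [Zero Hint] (i : Fin N) (prop : Hint) (aux : S.State) (pPC : PropagatorPC N Hint)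
    (gp : OpStatus (GlobalInv S.State) (GlobalRes S.State Hint)) (A : List Elem) :
    UpdatePC Elem → Prop
  | .updateHint | .zeroCounter | .signal => prop ≠ 0 ∧ S.Summarises aux A
  | .swap => prop ≠ 0 ∧ A = [] ∧ aux = S.empty
  | _ => (prop ≠ 0 → A = [] ∧ aux = S.empty) ∧ (prop = 0 → Handed S i aux gp A pPC)

/-- The invariant of update thread `i`: its operation is in state `o`, the global sketch contains
the stream `A`, `cb` are the calls whose elements are in the current buffer, and `pb` those whose
elements are in the auxiliary buffer and not yet in the global sketch. -/
structure UpdInv [Zero Hint] (b : ℕ) (i : Fin N) (pc : UpdatePC Elem) (cur : Bool) (counter : ℕ)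
    (hint prop : Hint) (loc : Bool → S.State) (pPC : PropagatorPC N Hint)
    (gp : OpStatus (GlobalInv S.State) (GlobalRes S.State Hint))
    (o : OpStatus (SketchInv Elem Arg) (SketchRes Val)) (A : List Elem)
    (cb pb : SeqHistory (OptThread N Q) (SketchInv Elem Arg) (SketchRes Val)) : Prop where
  op : OpInv o pc
  cur_state : S.Summarises (loc cur) (stream cb)
  count : CountInv b counter cb.length pc
  cb_upd : ∀ c ∈ cb, c.IsUpdate
  pb_upd : ∀ c ∈ pb, c.IsUpdate
  pb_len : pb.length ≤ b
  hint_good : S.GoodHint A hint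
  prop_good : prop ≠ 0 → S.GoodHint A prop
  target : pPC.target = some i → prop = 0
  aux : AuxInv S i prop (loc !cur) pPC gp (stream pb) pc

/-- The invariant of the propagator. -/
def PropInv [Zero Hint] (gp : OpStatus (GlobalInv S.State) (GlobalRes S.State Hint))
    (A : List Elem) : PropagatorPC N Hint → Prop
  | .merging _ => ∃ p s, gp.IsOpen p (.merge s)
  | .calculating _ => ∃ p, gp = .pending p .calcHint ∨
      ∃ h, gp = .done p .calcHint (.hint h) ∧ S.GoodHint A h
  | .setProp _ h => gp = .idle ∧ S.GoodHint A h
  | _ => gp = .idle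

/-- The invariant of a query thread. -/
def QryInv (o : OpStatus (SketchInv Elem Arg) (SketchRes Val))
    (gq : OpStatus (GlobalInv S.State) (GlobalRes S.State Hint)) : QueryPC Arg S.State → Prop
  | .idle => o = .idle ∧ gq = .idle
  | .snapshot x => (∃ p, o = .pending p (.query x)) ∧ gq = .idle
  | .snapshotting x => ∃ p p', (o = .pending p (.query x) ∧ gq = .pending p' .snapshot) ∨
      ∃ c, o = .done p (.query x) (.value (S.query c x)) ∧ gq = .done p' .snapshot (.copy c)
  | .respond x c => (∃ p, o = .done p (.query x) (.value (S.query c x))) ∧ gq = .idle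

variable {S}

/-- Only the two hints refer to the visible stream, and hints stay good as it grows. -/
theorem UpdInv.append [Zero Hint] {b : ℕ} {i : Fin N} {pc : UpdatePC Elem} {cur : Bool}
    {counter : ℕ} {hint prop : Hint} {loc : Bool → S.State} {pPC : PropagatorPC N Hint}
    {gp : OpStatus (GlobalInv S.State) (GlobalRes S.State Hint)}
    {o : OpStatus (SketchInv Elem Arg) (SketchRes Val)} {A : List Elem}
    {cb pb : SeqHistory (OptThread N Q) (SketchInv Elem Arg) (SketchRes Val)}
    (h : UpdInv S b i pc cur counter hint prop loc pPC gp o A cb pb) (A' : List Elem) :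
    UpdInv S b i pc cur counter hint prop loc pPC gp o (A ++ A') cb pb :=
  { h with
    hint_good := h.hint_good.append A'
    prop_good := fun hp => (h.prop_good hp).append A' }

theorem PropInv.append [Zero Hint]
    {gp : OpStatus (GlobalInv S.State) (GlobalRes S.State Hint)} {A : List Elem}
    {pPC : PropagatorPC N Hint} (h : PropInv S gp A pPC) (A' : List Elem) :
    PropInv S gp (A ++ A') pPC := by
  cases pPC <;> simp only [PropInv] at h ⊢ <;> try exact h
  · obtain ⟨p, h | ⟨x, h1, h2⟩⟩ := h
    · exact ⟨p, Or.inl h⟩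
    · exact ⟨p, Or.inr ⟨x, h1, h2.append A'⟩⟩
  · exact ⟨h.1, h.2.append A'⟩

/-- From leaving the wait until signalling, `prop` is nonzero and the update thread owns both
sketches. So `prop = 0` places the auxiliary sketch with the propagator. -/
theorem AuxInv.handed [Zero Hint] {i : Fin N} {prop : Hint} {aux : S.State}
    {pPC : PropagatorPC N Hint} {gp : OpStatus (GlobalInv S.State) (GlobalRes S.State Hint)}
    {A : List Elem} {pc : UpdatePC Elem} (h : AuxInv S i prop aux pPC gp A pc) (hp : prop = 0) :
    Handed S i aux gp A pPC := by
  cases pc <;> simp only [AuxInv] at h <;> first | exact h.2 hp | exact absurd hp h.1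

/-- The propagator works on an auxiliary buffer that has been handed over. -/
theorem AuxInv.of_handed [Zero Hint] {i : Fin N} {prop prop' : Hint} {aux aux' : S.State}
    {pPC pPC' : PropagatorPC N Hint}
    {gp gp' : OpStatus (GlobalInv S.State) (GlobalRes S.State Hint)}
    {A A' : List Elem} {pc : UpdatePC Elem} (h : AuxInv S i prop aux pPC gp A pc) (hp : prop = 0)
    (h1 : prop' ≠ 0 → A' = [] ∧ aux' = S.empty) (h2 : prop' = 0 → Handed S i aux' gp' A' pPC') :
    AuxInv S i prop' aux' pPC' gp' A' pc := by
  cases pc <;> simp only [AuxInv] at h ⊢ <;> first | exact ⟨h1, h2⟩ | exact absurd hp h.1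

theorem handed_of_target_ne {i : Fin N} {aux : S.State} {pPC : PropagatorPC N Hint}
    {gp : OpStatus (GlobalInv S.State) (GlobalRes S.State Hint)} {A : List Elem}
    (ht : pPC.target ≠ some i) : Handed S i aux gp A pPC ↔ S.Summarises aux A := by
  cases pPC <;> simp only [PropagatorPC.target, ne_eq, Option.some.injEq] at ht <;>
    simp [Handed, ht]

/-- The propagator interferes with an update thread only through a handed-over sketch, so the change
has to be justified only when `prop = 0`. -/
theorem UpdInv.imp [Zero Hint] {b : ℕ} {i : Fin N} {pc : UpdatePC Elem} {cur : Bool}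
    {counter : ℕ} {hint prop : Hint} {loc : Bool → S.State} {pPC pPC' : PropagatorPC N Hint}
    {gp gp' : OpStatus (GlobalInv S.State) (GlobalRes S.State Hint)}
    {o : OpStatus (SketchInv Elem Arg) (SketchRes Val)} {A : List Elem}
    {cb pb : SeqHistory (OptThread N Q) (SketchInv Elem Arg) (SketchRes Val)}
    (h : UpdInv S b i pc cur counter hint prop loc pPC gp o A cb pb)
    (ht : pPC'.target = some i → prop = 0)
    (h' : prop = 0 → Handed S i (loc !cur) gp (stream pb) pPC →
      Handed S i (loc !cur) gp' (stream pb) pPC') :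
    UpdInv S b i pc cur counter hint prop loc pPC' gp' o A cb pb := by
  refine { h with target := ht, aux := ?_ }
  by_cases hp : prop = 0
  · exact h.aux.of_handed hp (fun h0 => absurd hp h0) fun _ => h' hp (h.aux.handed hp)
  · have := h.aux
    cases pc <;> simp only [AuxInv] at this ⊢ <;>
      first | exact ⟨this.1, fun h0 => absurd h0 hp⟩ | exact this

end Invariant

/-! ### The invariant of the simulation and the bound on hidden updates -/

section Core

variable {Elem Arg Val Hint Q : Type*} [Zero Hint] [One Hint] [DecidableEq Q] {N : ℕ}

/-- The simulation invariant: `H` are the calls that have taken effect, `V` those that are visible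
to queries, in the order in which they become visible. -/
structure SimInv (S : ComposableSketch Elem Arg Val Hint Q) (b : ℕ) (s : OptState S N)
    (st : OptThread N Q → OpStatus (SketchInv Elem Arg) (SketchRes Val))
    (gst : GlobalThread Q → OpStatus (GlobalInv S.State) (GlobalRes S.State Hint))
    (H V : SeqHistory (OptThread N Q) (SketchInv Elem Arg) (SketchRes Val))
    (cb pb : Fin N → SeqHistory (OptThread N Q) (SketchInv Elem Arg) (SketchRes Val)) :
    Prop where
  split : Multiset.ofList V + ∑ i, (Multiset.ofList (cb i) + Multiset.ofList (pb i)) =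
    Multiset.ofList H
  early : Early (2 * N * b) H V
  run : S.SeqRun S.empty V
  upd : ∀ i, UpdInv S.toSketchMethods b i (s.updatePC i) (s.cur i) (s.counter i) (s.hint i)
    (s.prop i) (s.localS i) s.propagatorPC (gst .propagator) (st (.update i)) (stream V) (cb i)
    (pb i)
  prp : PropInv S.toSketchMethods (gst .propagator) (stream V) s.propagatorPC
  qry : ∀ j, QryInv S.toSketchMethods (st (.query j)) (gst (.query j)) (s.queryPC j)

variable {S : ComposableSketch Elem Arg Val Hint Q} {b : ℕ} {s s' : OptState S N}
  {st st' : OptThread N Q → OpStatus (SketchInv Elem Arg) (SketchRes Val)}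
  {gst gst' : GlobalThread Q → OpStatus (GlobalInv S.State) (GlobalRes S.State Hint)}
  {H H' V V' : SeqHistory (OptThread N Q) (SketchInv Elem Arg) (SketchRes Val)}
  {cb pb cb' pb' : Fin N → SeqHistory (OptThread N Q) (SketchInv Elem Arg) (SketchRes Val)}

namespace SimInv

/-- What `H` has and `V` lacks lies in the buffers, two for each of the `N` threads with at most `b`
calls each. -/
theorem length_le (h : SimInv S b s st gst H V cb pb) : H.length ≤ V.length + 2 * N * b := by
  have h1 := congrArg Multiset.card h.split
  simp only [Multiset.card_add, Multiset.coe_card, Multiset.card_sum] at h1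
  have h2 : ∑ i, ((cb i).length + (pb i).length) ≤ ∑ _i : Fin N, (b + b) :=
    Finset.sum_le_sum fun i _ => Nat.add_le_add (h.upd i).count.le (h.upd i).pb_len
  simp only [Finset.sum_const, Finset.card_univ, Fintype.card_fin, smul_eq_mul] at h2
  have h3 : N * (b + b) = 2 * N * b := by ring
  omega

theorem mem_of_mem_pb (h : SimInv S b s st gst H V cb pb) {i : Fin N}
    {c : Call (OptThread N Q) (SketchInv Elem Arg) (SketchRes Val)} (hc : c ∈ pb i) : c ∈ H := by
  rw [← Multiset.mem_coe (l := H), ← h.split]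
  refine Multiset.mem_add.2 (Or.inr (Multiset.mem_sum.2 ⟨i, Finset.mem_univ _, ?_⟩))
  exact Multiset.mem_add.2 (Or.inr hc)

/-- `V` is the witness; it has no repetitions because it is part of the multiset of `H`. -/
theorem mem_relaxed (h : SimInv S b s st gst H V cb pb) (hH : H.Nodup) :
    H ∈ Relaxed (SeqSketch S.toSketchMethods (OptThread N Q)) (2 * N * b) := by
  refine ⟨V, h.run, isRelaxation_of_take ?_ h.length_le h.early⟩
  have h1 : (Multiset.ofList H).Nodup := hH
  rw [← h.split] at h1
  exact (Multiset.nodup_add.1 h1).1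

end SimInv

/-- Changing the summand of one index. -/
theorem sum_eq_of_eq_off {M ι : Type*} [AddCommMonoid M] [Fintype ι] {f g : ι → M}
    (i : ι) {m n : M} (hi : f i + m = g i + n) (hne : ∀ j, j ≠ i → f j = g j) :
    ∑ j, f j + m = ∑ j, g j + n := by
  classical
  rw [← Finset.add_sum_erase _ f (Finset.mem_univ i),
    ← Finset.add_sum_erase _ g (Finset.mem_univ i),
    Finset.sum_congr rfl fun j hj => hne j (Finset.ne_of_mem_erase hj), add_right_comm, hi,
    add_right_comm]

end Core

/-! ### Steps of the update threads -/

section Steps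

variable {Elem Arg Val Hint Q : Type*} [Zero Hint] [One Hint] [DecidableEq Q] {N : ℕ}

variable {S : ComposableSketch Elem Arg Val Hint Q} {b : ℕ} {s s' : OptState S N}
  {st st' : OptThread N Q → OpStatus (SketchInv Elem Arg) (SketchRes Val)}
  {gst gst' : GlobalThread Q → OpStatus (GlobalInv S.State) (GlobalRes S.State Hint)}
  {H H' V V' : SeqHistory (OptThread N Q) (SketchInv Elem Arg) (SketchRes Val)}
  {cb pb cb' pb' : Fin N → SeqHistory (OptThread N Q) (SketchInv Elem Arg) (SketchRes Val)}
  {h : List (Event (OptThread N Q) (SketchInv Elem Arg) (SketchRes Val))}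

/-- The states `s` and `s'` differ at most in the variables of update thread `i`. -/
structure OptState.EqOff (s s' : OptState S N) (i : Fin N) : Prop where
  propagatorPC : s'.propagatorPC = s.propagatorPC
  queryPC : s'.queryPC = s.queryPC
  updatePC : ∀ k, k ≠ i → s'.updatePC k = s.updatePC k
  cur : ∀ k, k ≠ i → s'.cur k = s.cur k
  counter : ∀ k, k ≠ i → s'.counter k = s.counter k
  hint : ∀ k, k ≠ i → s'.hint k = s.hint k
  prop : ∀ k, k ≠ i → s'.prop k = s.prop k
  localS : ∀ k, k ≠ i → s'.localS k = s.localS k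

namespace SimInv

/-- A step of update thread `i` that moves the calls `w` into effect and makes the calls `v`
visible. -/
theorem of_thread (hs : SimInv S b s st gst H V cb pb) (i : Fin N) (he : s.EqOff s' i)
    {v w : SeqHistory (OptThread N Q) (SketchInv Elem Arg) (SketchRes Val)}
    (hst : ∀ t, t ≠ .update i → st' t = st t)
    (hcb : ∀ k, k ≠ i → cb' k = cb k ∧ pb' k = pb k)
    (hsplit : (Multiset.ofList (cb' i) + Multiset.ofList (pb' i)) + Multiset.ofList v =
      (Multiset.ofList (cb i) + Multiset.ofList (pb i)) + Multiset.ofList w)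
    (hearly : Early (2 * N * b) (H ++ w) (V ++ v))
    (hrun : S.SeqRun S.empty (V ++ v))
    (hu : UpdInv S.toSketchMethods b i (s'.updatePC i) (s'.cur i) (s'.counter i) (s'.hint i)
      (s'.prop i) (s'.localS i) s'.propagatorPC (gst .propagator) (st' (.update i))
      (stream (V ++ v)) (cb' i) (pb' i)) :
    SimInv S b s' st' gst (H ++ w) (V ++ v) cb' pb' where
  split := by
    have := sum_eq_of_eq_off
      (f := fun i => Multiset.ofList (cb' i) + Multiset.ofList (pb' i))
      (g := fun i => Multiset.ofList (cb i) + Multiset.ofList (pb i)) i hsplit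
      (fun k hk => by rw [(hcb k hk).1, (hcb k hk).2])
    rw [← Multiset.coe_add, ← Multiset.coe_add, add_assoc, add_comm (Multiset.ofList v), this,
      ← add_assoc, hs.split]
  early := hearly
  run := hrun
  upd k := by
    rcases eq_or_ne k i with rfl | hk
    · exact hu
    · have := (hs.upd k).append (stream v)
      rw [he.updatePC k hk, he.cur k hk, he.counter k hk, he.hint k hk, he.prop k hk,
        he.localS k hk, he.propagatorPC, (hcb k hk).1, (hcb k hk).2, stream_append,
        hst _ (by simpa using hk)]
      exact this
  prp := by
    rw [he.propagatorPC, stream_append]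
    exact hs.prp.append _
  qry j := by
    rw [he.queryPC, hst _ (by simp)]
    exact hs.qry j

/-- A step of update thread `i` that only changes its own variables and operation. -/
theorem of_thread_eq (hs : SimInv S b s st gst H V cb pb) (i : Fin N) (he : s.EqOff s' i)
    (hst : ∀ t, t ≠ .update i → st' t = st t)
    (hu : UpdInv S.toSketchMethods b i (s'.updatePC i) (s'.cur i) (s'.counter i) (s'.hint i)
      (s'.prop i) (s'.localS i) s'.propagatorPC (gst .propagator) (st' (.update i))
      (stream V) (cb i) (pb i)) :
    SimInv S b s' st' gst H V cb pb := by
  have := hs.of_thread (v := []) (w := []) (cb' := cb) (pb' := pb) i he hst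
    (fun _ _ => ⟨rfl, rfl⟩) rfl (by simpa using hs.early) (by simpa using hs.run)
    (by simpa using hu)
  simpa using this

end SimInv

/-- The only calls that an update thread makes visible itself are filtered updates. They leave the
summary unchanged, which is the last conjunct: the global sketch needs no step to follow them. -/
theorem update_step (hb : 0 < b) {i : Fin N}
    {α : StepAction (SketchInv Elem Arg) (SketchRes Val)} (hstep : OptStep S N b s (.update i) α s')
    (hs : SimInv S b s st gst H V cb pb) (hl : Linearises h st H) :
    ∃ st' w v cb' pb', SimInv S b s' st' gst (H ++ w) (V ++ v) cb' pb' ∧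
      Linearises (h ++ (α.event? (.update i)).toList) st' (H ++ w) ∧
      s'.globalS = s.globalS ∧
        ∀ x, S.Summarises x (stream V) → S.Summarises x (stream (V ++ v)) := by
  have hu := hs.upd i
  have same : ∀ s'', s.EqOff s'' i → s''.globalS = s.globalS →
      UpdInv S.toSketchMethods b i (s''.updatePC i) (s''.cur i) (s''.counter i) (s''.hint i)
        (s''.prop i) (s''.localS i) s''.propagatorPC (gst .propagator) (st (.update i))
        (stream V) (cb i) (pb i) →
      ∃ st' w v cb' pb', SimInv S b s'' st' gst (H ++ w) (V ++ v) cb' pb' ∧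
      Linearises (h ++ []) st' (H ++ w) ∧
      s''.globalS = s.globalS ∧
        ∀ x, S.Summarises x (stream V) → S.Summarises x (stream (V ++ v)) := by
    intro s'' he hg hu'
    refine ⟨st, [], [], cb, pb, ?_, by simpa using hl, hg, by simp⟩
    simpa using hs.of_thread_eq i he (fun _ _ => rfl) hu'
  cases hstep with
  | u_invoke _ a hpc =>
    rw [hpc] at hu
    refine ⟨Function.update st (.update i) (.pending h.length (.update a)), [], [], cb, pb, ?_,
      by simpa [StepAction.event?] using hl.invoke hu.op _, rfl, by simp⟩
    simp only [List.append_nil]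
    refine hs.of_thread_eq i ?_ (fun t ht => Function.update_of_ne ht _ _) ?_
    · constructor <;> simp +contextual [OptState.gotoU]
    · simp only [OptState.gotoU, Function.update_self]
      exact { hu with op := ⟨_, rfl⟩, count := hu.count, aux := hu.aux }
  | u_filter _ a hpc ha =>
    rw [hpc] at hu
    obtain ⟨p, hp⟩ := hu.op
    -- The thread's hint is good for the whole visible stream; with `B` empty, appending `a` does
    -- not change the summary.
    have hsum : ∀ x, S.Summarises x (stream V) → S.Summarises x (stream V ++ [a]) := by
      rintro x rfl
      have := hu.hint_good.2 a ha [] _ (by rw [SketchMethods.Summarises])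
      rw [List.append_nil] at this
      exact this.symm
    have hlen := hs.length_le
    refine ⟨Function.update st (.update i) (.done p (.update a) .ack),
      [⟨p, .update i, .update a, .ack⟩], [⟨p, .update i, .update a, .ack⟩], cb, pb, ?_,
      by simpa [StepAction.event?] using hl.linearise hp _, rfl, ?_⟩
    · refine hs.of_thread i ?_ (fun t ht => Function.update_of_ne ht _ _) (fun _ _ => ⟨rfl, rfl⟩)
        rfl ?_ ?_ ?_
      · constructor <;> simp +contextual [OptState.gotoU]
      · exact (hs.early.append_left _).append_right (by simpa using hlen) (by simp)
      · rw [S.seqRun_append]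
        exact ⟨hs.run, S.seqRun_of_isUpdate _ _ (by simp [Call.IsUpdate])⟩
      · simp only [OptState.gotoU, Function.update_self]
        rw [stream_append]
        exact { hu.append _ with op := ⟨_, _, rfl⟩, count := hu.count, aux := hu.aux }
    · simpa only [stream_append, stream_update] using hsum
  | u_add _ a hpc ha =>
    rw [hpc] at hu
    refine same _ ?_ rfl ?_
    · constructor <;> simp +contextual [OptState.gotoU]
    · simp only [OptState.gotoU, Function.update_self]
      exact { hu with op := hu.op, count := hu.count, aux := hu.aux }
  | u_incCounter _ a hpc =>
    rw [hpc] at hu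
    refine same _ ?_ rfl ?_
    · constructor <;> simp +contextual [OptState.gotoU]
    · simp only [OptState.gotoU, Function.update_self]
      exact { hu with op := hu.op, count := ⟨by rw [hu.count.1], hu.count.2⟩, aux := hu.aux }
  | u_updateLocal _ a hpc =>
    rw [hpc] at hu
    obtain ⟨p, hp⟩ := hu.op
    have hcur := hu.cur_state
    -- The call takes effect now but stays hidden: it joins `H` and the current buffer, and `V` does
    -- not move.
    refine ⟨Function.update st (.update i) (.done p (.update a) .ack),
      [⟨p, .update i, .update a, .ack⟩], [],
      Function.update cb i (cb i ++ [⟨p, .update i, .update a, .ack⟩]), pb, ?_,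
      by simpa [StepAction.event?] using hl.linearise hp _, rfl, by simp⟩
    refine hs.of_thread i ?_ (fun t ht => Function.update_of_ne ht _ _)
      (fun k hk => ⟨Function.update_of_ne hk _ _, rfl⟩) ?_ ?_ (by simpa using hs.run) ?_
    · constructor <;> simp +contextual [OptState.gotoU, OptState.setLocal]
    · rw [Function.update_self, ← Multiset.coe_add, Multiset.coe_nil, add_zero, add_right_comm]
    · simpa using hs.early.append_left _
    · simp only [OptState.gotoU, OptState.setLocal, Function.update_self, List.append_nil]
      refine { hu with op := ⟨_, _, rfl⟩, count := ?_, aux := ?_, cur_state := ?_, cb_upd := ?_ }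
      · rw [Function.update_self, stream_append, stream_update, hcur]
        simp [SketchMethods.Summarises]
      · have := hu.count
        simp only [CountInv, List.length_append, List.length_singleton] at this ⊢
        omega
      · intro c hc
        rcases List.mem_append.1 hc with hc | hc
        · exact hu.cb_upd c hc
        · simp only [List.mem_singleton] at hc
          subst hc
          exact ⟨⟨_, rfl⟩, rfl⟩
      · rw [Function.update_of_ne (by simp)]
        exact hu.aux
  | u_notFull _ hpc hn =>
    rw [hpc] at hu
    refine same _ ?_ rfl ?_
    · constructor <;> simp +contextual [OptState.gotoU]
    · simp only [OptState.gotoU, Function.update_self]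
      have := hu.count
      refine { hu with op := hu.op, count := ⟨this.1, lt_of_le_of_ne this.2 ?_⟩, aux := hu.aux }
      rw [← this.1]
      exact hn
  | u_full _ hpc hn =>
    rw [hpc] at hu
    refine same _ ?_ rfl ?_
    · constructor <;> simp +contextual [OptState.gotoU]
    · simp only [OptState.gotoU, Function.update_self]
      exact { hu with op := hu.op, count := hu.count.1.symm.trans hn, aux := hu.aux }
  | u_wait _ hpc hn =>
    rw [hpc] at hu
    refine same _ ?_ rfl ?_
    · constructor <;> simp +contextual [OptState.gotoU]
    · simp only [OptState.gotoU, Function.update_self]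
      have := hu.aux.1 hn
      exact { hu with op := hu.op, count := hu.count, aux := ⟨hn, this⟩ }
  | u_swap _ hpc =>
    rw [hpc] at hu
    obtain ⟨hprop, hpb, haux⟩ := hu.aux
    -- Every call in `pb i` is an update and so contributes an element; an empty stream leaves no
    -- calls.
    have hpb' : pb i = [] := by
      rw [List.eq_nil_iff_forall_not_mem]
      intro c hc
      obtain ⟨⟨a, ha⟩, -⟩ := hu.pb_upd c hc
      have : a ∈ stream (pb i) := List.mem_filterMap.2 ⟨c, hc, by rw [ha]⟩
      rw [hpb] at this
      simp at this
    -- The full buffer becomes the auxiliary one. Nothing is lost, since the old auxiliary buffer is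
    -- empty, and its empty sketch becomes the current one.
    refine ⟨st, [], [], Function.update cb i [], Function.update pb i (cb i), ?_,
      by simpa [StepAction.event?] using hl, rfl, by simp⟩
    refine hs.of_thread i ?_ (fun _ _ => rfl)
      (fun k hk => ⟨Function.update_of_ne hk _ _, Function.update_of_ne hk _ _⟩) ?_
      (by simpa using hs.early) (by simpa using hs.run) ?_
    · constructor <;> simp +contextual [OptState.gotoU]
    · simp [hpb']
    · simp only [OptState.gotoU, Function.update_self, List.append_nil]
      have hcount : (cb i).length = b := hu.count
      exact { hu with
        op := hu.op
        count := rfl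
        aux := ⟨hprop, by simpa using hu.cur_state⟩
        cur_state := haux
        cb_upd := by simp
        pb_upd := hu.cb_upd
        pb_len := hcount.le }
  | u_updateHint _ hpc =>
    rw [hpc] at hu
    refine same _ ?_ rfl ?_
    · constructor <;> simp +contextual [OptState.gotoU]
    · simp only [OptState.gotoU, Function.update_self]
      exact { hu with
        op := hu.op
        count := hu.count
        aux := hu.aux
        hint_good := hu.prop_good hu.aux.1 }
  | u_zeroCounter _ hpc =>
    rw [hpc] at hu
    refine same _ ?_ rfl ?_
    · constructor <;> simp +contextual [OptState.gotoU]
    · simp only [OptState.gotoU, Function.update_self]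
      exact { hu with op := hu.op, count := ⟨rfl, hu.count⟩, aux := hu.aux }
  | u_signal _ hpc =>
    rw [hpc] at hu
    refine same _ ?_ rfl ?_
    · constructor <;> simp +contextual [OptState.gotoU]
    · simp only [OptState.gotoU, Function.update_self]
      obtain ⟨hcount, hlen⟩ := hu.count
      obtain ⟨hprop, haux⟩ := hu.aux
      -- As long as `prop` is nonzero the propagator cannot be working for `i`, so at the handover
      -- only the contents of the sketch matter.
      have ht : s.propagatorPC.target ≠ some i := fun h0 => hprop (hu.target h0)
      exact { hu with
        op := hu.op
        count := ⟨by rw [hcount, hlen], by rwa [hlen]⟩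
        aux := ⟨fun h0 => absurd rfl h0, fun _ => (handed_of_target_ne ht).2 haux⟩
        prop_good := fun h0 => absurd rfl h0
        target := fun _ => rfl }
  | u_respond _ hpc =>
    rw [hpc] at hu
    obtain ⟨p, a, hp⟩ := hu.op
    refine ⟨Function.update st (.update i) .idle, [], [], cb, pb, ?_,
      by simpa [StepAction.event?] using hl.respond hp, rfl, by simp⟩
    simp only [List.append_nil]
    refine hs.of_thread_eq i ?_ (fun t ht => Function.update_of_ne ht _ _) ?_
    · constructor <;> simp +contextual [OptState.gotoU]
    · simp only [OptState.gotoU, Function.update_self]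
      exact { hu with op := rfl, count := hu.count, aux := hu.aux }

end Steps

/-! ### Merges, hint computations and snapshots taking effect -/

section GlobalSteps

variable {Elem Arg Val Hint Q : Type*} [Zero Hint] [One Hint] [DecidableEq Q] {N : ℕ}

variable {S : ComposableSketch Elem Arg Val Hint Q} {b : ℕ} {s s' : OptState S N}
  {st st' : OptThread N Q → OpStatus (SketchInv Elem Arg) (SketchRes Val)}
  {gst gst' : GlobalThread Q → OpStatus (GlobalInv S.State) (GlobalRes S.State Hint)}
  {H H' V V' : SeqHistory (OptThread N Q) (SketchInv Elem Arg) (SketchRes Val)}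
  {cb pb cb' pb' : Fin N → SeqHistory (OptThread N Q) (SketchInv Elem Arg) (SketchRes Val)}
  {h : List (Event (OptThread N Q) (SketchInv Elem Arg) (SketchRes Val))}

namespace SimInv

/-- Steps of the global sketch do not matter. -/
theorem globalS (hs : SimInv S b s st gst H V cb pb) (g : S.shared.Config) :
    SimInv S b { s with globalS := g } st gst H V cb pb :=
  ⟨hs.split, hs.early, hs.run, hs.upd, hs.prp, hs.qry⟩

/-- A change of the operation of the propagator on the global sketch and of its program counter. -/
theorem of_propagator (hs : SimInv S b s st gst H V cb pb) {pPC : PropagatorPC N Hint}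
    {o : OpStatus (GlobalInv S.State) (GlobalRes S.State Hint)} (g : S.shared.Config)
    (hu : ∀ i, pPC.target = some i → s.prop i = 0)
    (hh : ∀ i, s.prop i = 0 →
      Handed S.toSketchMethods i (s.localS i !(s.cur i)) (gst .propagator) (stream (pb i))
        s.propagatorPC →
      Handed S.toSketchMethods i (s.localS i !(s.cur i)) o (stream (pb i)) pPC)
    (hp : PropInv S.toSketchMethods o (stream V) pPC) :
    SimInv S b { s with globalS := g, propagatorPC := pPC } st
      (Function.update gst .propagator o) H V cb pb where
  split := hs.split
  early := hs.early
  run := hs.run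
  upd i := by
    rw [Function.update_self]
    exact (hs.upd i).imp (hu i) (hh i)
  prp := by rwa [Function.update_self]
  qry j := by
    rw [Function.update_of_ne (by simp)]
    exact hs.qry j

/-- A change of the operation of a query thread, of its operation on the global sketch and of its
program counter. -/
theorem of_query (hs : SimInv S b s st gst H V cb pb) (j : Q) {pc : QueryPC Arg S.State}
    {o : OpStatus (SketchInv Elem Arg) (SketchRes Val)}
    {o' : OpStatus (GlobalInv S.State) (GlobalRes S.State Hint)} (g : S.shared.Config)
    (hq : QryInv S.toSketchMethods o o' pc) :
    SimInv S b { s with globalS := g, queryPC := Function.update s.queryPC j pc }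
      (Function.update st (.query j) o) (Function.update gst (.query j) o') H V cb pb where
  split := hs.split
  early := hs.early
  run := hs.run
  upd i := by
    rw [Function.update_of_ne (by simp), Function.update_of_ne (by simp)]
    exact hs.upd i
  prp := by
    rw [Function.update_of_ne (by simp)]
    exact hs.prp
  qry k := by
    rcases eq_or_ne k j with rfl | hk
    · simpa using hq
    · simpa [hk] using hs.qry k

/-- A pending operation of the propagator on the global sketch takes effect. -/
theorem linearise_propagator (hs : SimInv S b s st gst H V cb pb) {p : ℕ}
    {i : GlobalInv S.State} {r : GlobalRes S.State Hint} {g : S.State}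
    (hp : gst .propagator = .pending p i) (hg : S.Summarises g (stream V))
    (hrun : S.GlobalRun g [⟨p, GlobalThread.propagator (Q := Q), i, r⟩]) :
    ∃ v pb', SimInv S b s st (Function.update gst .propagator (.done p i r)) H (V ++ v) cb pb' ∧
      S.Summarises (S.globalFinal g [⟨p, GlobalThread.propagator (Q := Q), i, r⟩])
        (stream (V ++ v)) := by
  have hprp := hs.prp
  have hqry : ∀ j, QryInv S.toSketchMethods (st (.query j))
      (Function.update gst .propagator (.done p i r) (.query j)) (s.queryPC j) := fun j => by
    rw [Function.update_of_ne (by simp)]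
    exact hs.qry j
  cases hpc : s.propagatorPC with
  | merging k =>
    simp only [hpc, PropInv, hp, OpStatus.IsOpen, OpStatus.pending.injEq, reduceCtorEq,
      exists_false, or_false] at hprp
    obtain ⟨_, x, rfl, rfl⟩ := hprp
    have hu := hs.upd k
    have hk : s.prop k = 0 := hu.target (by rw [hpc]; rfl)
    have hx : S.Summarises x (stream (pb k)) := by
      have := hu.aux.handed hk
      simp only [hpc, Handed, if_true, hp, OpStatus.pending.injEq, GlobalInv.merge.injEq,
        reduceCtorEq, false_and, exists_false, or_false] at this
      obtain ⟨_, _, ⟨-, rfl⟩, h1⟩ := this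
      exact h1
    -- The merge makes the whole auxiliary buffer visible. Its calls are already in `H`, which does
    -- not change.
    refine ⟨pb k, Function.update pb k [], ⟨?_, ?_, ?_, fun i => ?_, ?_, hqry⟩, ?_⟩
    · have := sum_eq_of_eq_off
        (f := fun i => Multiset.ofList (cb i) + Multiset.ofList (Function.update pb k [] i))
        (g := fun i => Multiset.ofList (cb i) + Multiset.ofList (pb i)) k
        (m := Multiset.ofList (pb k)) (n := 0) (by simp)
        (fun j hj => by rw [Function.update_of_ne hj])
      rw [← hs.split, ← Multiset.coe_add, add_assoc, add_comm (Multiset.ofList (pb k)), this,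
        add_zero]
    · exact hs.early.append_right (hs.length_le.trans (Nat.le_succ _)) fun c hc =>
        hs.mem_of_mem_pb hc
    · exact (S.seqRun_append _ _ _).2 ⟨hs.run, S.seqRun_of_isUpdate _ _ hu.pb_upd⟩
    · rw [Function.update_self, stream_append]
      rcases eq_or_ne i k with rfl | hi
      · rw [Function.update_self]
        refine { hu.append _ with pb_upd := by simp, pb_len := Nat.zero_le _, aux := ?_ }
        refine hu.aux.of_handed hk (fun h0 => absurd hk h0) fun _ => ?_
        simp only [hpc, Handed, if_true]
        exact ⟨_, _, Or.inr ⟨_, rfl, rfl⟩⟩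
      · rw [Function.update_of_ne hi]
        refine ((hs.upd i).append _).imp (hs.upd i).target fun _ h1 => ?_
        simpa [hpc, Handed, hi.symm] using h1
    · rw [Function.update_self, hpc]
      exact ⟨_, _, Or.inr ⟨_, rfl⟩⟩
    · rw [stream_append]
      exact S.merge_summarises _ _ _ _ hg hx
  | calculating k =>
    simp only [hpc, PropInv, hp, OpStatus.pending.injEq, reduceCtorEq, false_and,
      exists_false, or_false] at hprp
    obtain ⟨_, rfl, rfl⟩ := hprp
    obtain ⟨hr, -⟩ := hrun
    simp only at hr
    subst hr
    refine ⟨[], pb, ⟨?_, ?_, ?_, fun i => ?_, ?_, hqry⟩, ?_⟩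
    · simpa using hs.split
    · simpa using hs.early
    · simpa using hs.run
    · rw [Function.update_self, List.append_nil]
      refine (hs.upd i).imp (hs.upd i).target fun _ h1 => ?_
      simpa only [hpc, Handed] using h1
    · rw [Function.update_self, hpc, List.append_nil]
      exact ⟨_, Or.inr ⟨_, rfl, S.goodHint_calcHint hg⟩⟩
    · rw [List.append_nil]
      exact hg
  -- Elsewhere the propagator has no pending operation: for `setProp` as well as the remaining
  -- counters its status is idle.
  | _ => simp [hpc, PropInv, hp] at hprp

/-- A pending operation of a query thread on the global sketch takes effect. -/
theorem linearise_query (hs : SimInv S b s st gst H V cb pb) (hl : Linearises h st H) {j : Q}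
    {p : ℕ} {i : GlobalInv S.State} {r : GlobalRes S.State Hint} {g : S.State}
    (hp : gst (.query j) = .pending p i) (hg : S.Summarises g (stream V))
    (hrun : S.GlobalRun g [⟨p, GlobalThread.query j, i, r⟩]) :
    ∃ st' w v, SimInv S b s st' (Function.update gst (.query j) (.done p i r)) (H ++ w)
        (V ++ v) cb pb ∧ Linearises h st' (H ++ w) ∧
      S.Summarises (S.globalFinal g [⟨p, GlobalThread.query j, i, r⟩]) (stream (V ++ v)) := by
  have hqry := hs.qry j
  cases hpc : s.queryPC j with
  | snapshotting x =>
    simp only [hpc, QryInv, hp, OpStatus.pending.injEq, reduceCtorEq, and_false,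
      exists_false, or_false] at hqry
    obtain ⟨q, _, hq, rfl, rfl⟩ := hqry
    obtain ⟨⟨y, hy, hyg⟩, -⟩ := hrun
    simp only at hy
    subst hy
    have hlen := hs.length_le
    -- The query is answered when the snapshot takes effect, possibly before the thread receives the
    -- copy: `f` already fixes the copy `y`, hence the value.
    refine ⟨Function.update st (.query j) (.done q (.query x) (.value (S.query y x))),
      [⟨q, .query j, .query x, .value (S.query y x)⟩],
      [⟨q, .query j, .query x, .value (S.query y x)⟩], ⟨?_, ?_, ?_, fun i => ?_, ?_, fun k => ?_⟩,
      hl.linearise hq _, ?_⟩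
    · rw [← Multiset.coe_add, ← Multiset.coe_add, ← hs.split, add_right_comm]
    · exact (hs.early.append_left _).append_right (by simpa using hlen) (by simp)
    · refine (S.seqRun_append _ _ _).2 ⟨hs.run, ?_⟩
      rw [← hg]
      exact ⟨by rw [hyg], trivial⟩
    · rw [Function.update_of_ne (by simp), Function.update_of_ne (by simp), stream_append]
      exact (hs.upd i).append _
    · rw [Function.update_of_ne (by simp), stream_append]
      exact hs.prp.append _
    · rcases eq_or_ne k j with rfl | hk
      · rw [Function.update_self, Function.update_self, hpc]
        exact ⟨_, _, Or.inr ⟨_, rfl, rfl⟩⟩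
      · rw [Function.update_of_ne (by simpa using hk), Function.update_of_ne (by simpa using hk)]
        exact hs.qry k
    · rw [stream_append, stream_query, List.append_nil]
      exact hg
  | _ => simp [hpc, QryInv, hp] at hqry

/-- Operations on the global sketch take effect. -/
theorem absorb {gh : List (Event (GlobalThread Q) (GlobalInv S.State) (GlobalRes S.State Hint))}
    {L : SeqHistory (GlobalThread Q) (GlobalInv S.State) (GlobalRes S.State Hint)}
    (M : SeqHistory (GlobalThread Q) (GlobalInv S.State) (GlobalRes S.State Hint))
    (hs : SimInv S b s st gst H V cb pb) (hl : Linearises h st H) (hgl : Linearises gh gst L)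
    {g : S.State} (hg : S.Summarises g (stream V)) (hrun : S.GlobalRun g M)
    (hnodup : ((L ++ M).map Call.id).Nodup)
    (hinv : ∀ c ∈ M, gh[c.id]? = some (.inv c.thread c.inv)) :
    ∃ st' gst' w v pb', SimInv S b s st' gst' (H ++ w) (V ++ v) cb pb' ∧
      Linearises h st' (H ++ w) ∧ Linearises gh gst' (L ++ M) ∧
      S.Summarises (S.globalFinal g M) (stream (V ++ v)) := by
  induction M generalizing st gst H V pb L g with
  | nil => exact ⟨st, gst, [], [], pb, by simpa using hs, by simpa using hl, by simpa using hgl,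
      by rw [List.append_nil]; exact hg⟩
  | cons c M ih =>
    -- Identifiers in `L ++ M` are distinct, so the operation of `c` has not taken effect yet and
    -- must be pending.
    have hn : ∀ c' ∈ L, c'.id ≠ c.id := by
      rw [List.map_append, List.nodup_append] at hnodup
      exact fun c' hc' => hnodup.2.2 _ (List.mem_map_of_mem hc') _ (by simp)
    have hpend := hgl.pending_of_invoked (hinv c (by simp)) hn
    have hgl' := hgl.linearise hpend c.res
    have hrun' := (S.globalRun_append g [c] M).1 hrun
    have hfin := S.globalFinal_append g [c] M
    rw [List.singleton_append] at hfin
    have hassoc : L ++ c :: M = (L ++ [c]) ++ M := by simp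
    obtain ⟨st₁, w, v, pb₁, hs₁, hl₁, hg₁⟩ : ∃ st' w v pb',
        SimInv S b s st' (Function.update gst c.thread (.done c.id c.inv c.res)) (H ++ w) (V ++ v)
          cb pb' ∧ Linearises h st' (H ++ w) ∧
        S.Summarises (S.globalFinal g [c]) (stream (V ++ v)) := by
      obtain ⟨p, t, i, r⟩ := c
      cases t with
      | propagator =>
        obtain ⟨v, pb', h1, h2⟩ := hs.linearise_propagator hpend hg hrun'.1
        exact ⟨st, [], v, pb', by simpa using h1, by simpa using hl, h2⟩
      | query j =>
        obtain ⟨st', w, v, h1, h2, h3⟩ := hs.linearise_query hl hpend hg hrun'.1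
        exact ⟨st', w, v, pb, h1, h2, h3⟩
    obtain ⟨st₂, gst₂, w₂, v₂, pb₂, hs₂, hl₂, hgl₂, hg₂⟩ := ih hs₁ hl₁ hgl' hg₁ hrun'.2
      (by rwa [← hassoc]) (fun c' hc' => hinv c' (List.mem_cons_of_mem _ hc'))
    refine ⟨st₂, gst₂, w ++ w₂, v ++ v₂, pb₂, ?_, ?_, ?_, ?_⟩
    · simpa only [List.append_assoc] using hs₂
    · simpa only [List.append_assoc] using hl₂
    · rwa [hassoc]
    · rw [hfin]
      simpa only [List.append_assoc] using hg₂

end SimInv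

end GlobalSteps

/-! ## Following the implementation of the global sketch -/

section Shared

variable {Elem Arg Val Hint Q : Type*} [Zero Hint] [One Hint] [DecidableEq Q] {N : ℕ}

/-- The implementation of the global sketch, used as the algorithm uses it. -/
abbrev ComposableSketch.sharedAlgorithm (S : ComposableSketch Elem Arg Val Hint Q) :
    Algorithm (GlobalThread Q) (GlobalInv S.State) (GlobalRes S.State Hint) :=
  S.shared.toAlgorithm S.toSketchMethods.GlobalAllowed

variable {S : ComposableSketch Elem Arg Val Hint Q} {b : ℕ} {s s' : OptState S N}
  {st : OptThread N Q → OpStatus (SketchInv Elem Arg) (SketchRes Val)}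
  {gst : GlobalThread Q → OpStatus (GlobalInv S.State) (GlobalRes S.State Hint)}
  {H V : SeqHistory (OptThread N Q) (SketchInv Elem Arg) (SketchRes Val)}
  {cb pb : Fin N → SeqHistory (OptThread N Q) (SketchInv Elem Arg) (SketchRes Val)}
  {h : List (Event (OptThread N Q) (SketchInv Elem Arg) (SketchRes Val))}

/-- The function `f` linearises the executions of the global sketch. -/
structure LinearisesShared (S : ComposableSketch Elem Arg Val Hint Q)
    (f : List S.sharedAlgorithm.ExecStep →
      SeqHistory (GlobalThread Q) (GlobalInv S.State) (GlobalRes S.State Hint)) : Prop where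
  mono : ∀ τ τ', S.sharedAlgorithm.IsExecution τ → S.sharedAlgorithm.IsExecution τ' → τ <+: τ' →
    f τ <+: f τ'
  run : ∀ τ, S.sharedAlgorithm.IsExecution τ → S.GlobalRun S.empty (f τ)
  ser : ∀ τ, S.sharedAlgorithm.IsExecution τ →
    IsSerialisation (S.sharedAlgorithm.history τ) (f τ)

/-- The execution `τ` of the global sketch leads to the configuration `g`, in which the global
sketch summarises the stream `A`. -/
structure SharedInv (f : List S.sharedAlgorithm.ExecStep →
      SeqHistory (GlobalThread Q) (GlobalInv S.State) (GlobalRes S.State Hint))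
    (g : S.shared.Config) (τ : List S.sharedAlgorithm.ExecStep)
    (gst : GlobalThread Q → OpStatus (GlobalInv S.State) (GlobalRes S.State Hint))
    (A : List Elem) : Prop where
  exec : S.sharedAlgorithm.IsExecution τ
  endState : S.sharedAlgorithm.endState S.sharedAlgorithm.init τ = g
  lin : Linearises (S.sharedAlgorithm.history τ) gst (f τ)
  sum : S.Summarises (S.globalFinal S.empty (f τ)) A

/-- The invariant of the simulation, without the auxiliary data. -/
def FullInv (S : ComposableSketch Elem Arg Val Hint Q) (b : ℕ)
    (f : List S.sharedAlgorithm.ExecStep →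
      SeqHistory (GlobalThread Q) (GlobalInv S.State) (GlobalRes S.State Hint))
    (s : OptState S N) (h : List (Event (OptThread N Q) (SketchInv Elem Arg) (SketchRes Val)))
    (H : SeqHistory (OptThread N Q) (SketchInv Elem Arg) (SketchRes Val)) : Prop :=
  ∃ τ st gst V cb pb, SimInv S b s st gst H V cb pb ∧ Linearises h st H ∧
    SharedInv f s.globalS τ gst (stream V)

variable {f : List S.sharedAlgorithm.ExecStep →
    SeqHistory (GlobalThread Q) (GlobalInv S.State) (GlobalRes S.State Hint)}
  {τ : List S.sharedAlgorithm.ExecStep} {g g' : S.shared.Config}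

/-- The algorithm drives the shared sketch without restriction, whereas `f` is only known on
executions that obey `GlobalAllowed`. Only invocations have to be checked. -/
theorem SharedInv.exec_concat {A : List Elem} (hτ : SharedInv f g τ gst A) {t : GlobalThread Q}
    {α : StepAction (GlobalInv S.State) (GlobalRes S.State Hint)} (hstep : S.SharedStep g t α g')
    (hall : ∀ i, α = .inv i → S.GlobalAllowed t i) :
    S.sharedAlgorithm.IsExecution (τ ++ [((t, α, g') : S.sharedAlgorithm.ExecStep)]) := by
  refine (Algorithm.isPath_concat _ _ _ _ _ _).2 ⟨hτ.exec, ?_⟩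
  rw [hτ.endState]
  cases hstep with
  | invoke m p _ i _ hp => exact .invoke m p t i (hall i rfl) hp
  | internal m m' p _ l l' hp hn => exact .internal m m' p t l l' hp hn
  | respond m m' p _ l r hp hn => exact .respond m m' p t l r hp hn

/-- Operations on the global sketch that take effect in its next step. -/
theorem SimInv.absorb_step (hf : LinearisesShared S f) (hs : SimInv S b s st gst H V cb pb)
    (hl : Linearises h st H) {e : S.sharedAlgorithm.ExecStep}
    (hτ : S.sharedAlgorithm.IsExecution τ) (hτe : S.sharedAlgorithm.IsExecution (τ ++ [e]))
    {gh : List (Event (GlobalThread Q) (GlobalInv S.State) (GlobalRes S.State Hint))}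
    (hgh : ∀ (p : ℕ) (t : GlobalThread Q) (i : GlobalInv S.State),
      (S.sharedAlgorithm.history (τ ++ [e]))[p]? = some (Event.inv t i) →
        gh[p]? = some (Event.inv t i))
    (hgl : Linearises gh gst (f τ))
    (hsum : S.Summarises (S.globalFinal S.empty (f τ)) (stream V)) :
    ∃ st' gst' w v pb', SimInv S b s st' gst' (H ++ w) (V ++ v) cb pb' ∧
      Linearises h st' (H ++ w) ∧ Linearises gh gst' (f (τ ++ [e])) ∧
      S.Summarises (S.globalFinal S.empty (f (τ ++ [e]))) (stream (V ++ v)) := by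
  -- Strong linearisability of the shared sketch enters here: the longer execution only appends
  -- calls `M`, possibly of several threads.
  obtain ⟨M, hM⟩ := hf.mono _ _ hτ hτe (List.prefix_append _ _)
  have hrun := hf.run _ hτe
  have hser := hf.ser _ hτe
  rw [← hM] at hrun hser
  obtain ⟨st', gst', w, v, pb', h1, h2, h3, h4⟩ := hs.absorb M hl hgl hsum
    ((S.globalRun_append _ _ _).1 hrun).2 hser.nodup
    (fun c hc => hgh _ _ _ (hser.invoked c (List.mem_append_right _ hc)))
  rw [← S.globalFinal_append] at h4
  rw [hM] at h3 h4
  exact ⟨st', gst', w, v, pb', h1, h2, h3, h4⟩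

theorem FullInv.shared_tau (hf : LinearisesShared S f) (hi : FullInv S b f s h H)
    {t : GlobalThread Q} (hstep : S.SharedStep s.globalS t .tau g) :
    ∃ H', H <+: H' ∧ FullInv S b f { s with globalS := g } h H' := by
  obtain ⟨τ, st, gst, V, cb, pb, hs, hl, hτ⟩ := hi
  have hτe := hτ.exec_concat hstep (by simp)
  have hhist := S.sharedAlgorithm.history_concat τ (t, .tau, g)
  simp only [StepAction.event?, Option.toList_none, List.append_nil] at hhist
  obtain ⟨st', gst', w, v, pb', h1, h2, h3, h4⟩ := hs.absorb_step hf hl hτ.exec hτe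
    (fun p t i h0 => by rwa [hhist] at h0) hτ.lin hτ.sum
  exact ⟨H ++ w, List.prefix_append _ _, _, st', gst', V ++ v, cb, pb', h1.globalS g, h2,
    hτe, Algorithm.endState_concat _ _ _ _, by rwa [hhist], h4⟩

/-- The invocation is recorded before the new calls are absorbed, because the operation may take
effect in this very step. -/
theorem SharedInv.invoke (hf : LinearisesShared S f) {A : List Elem} (hτ : SharedInv f g τ gst A)
    (hA : A = stream V) {t : GlobalThread Q}
    {i : GlobalInv S.State} (hstep : S.SharedStep g t (.inv i) s'.globalS)
    (hall : S.GlobalAllowed t i) (hidle : gst t = .idle) (hl : Linearises h st H)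
    (hs : ∀ p, SimInv S b s' st (Function.update gst t (.pending p i)) H V cb pb) :
    ∃ H', H <+: H' ∧ FullInv S b f s' h H' := by
  subst hA
  have hτe := hτ.exec_concat hstep (by rintro _ ⟨⟩; exact hall)
  have hhist := S.sharedAlgorithm.history_concat τ (t, .inv i, s'.globalS)
  simp only [StepAction.event?, Option.toList_some] at hhist
  obtain ⟨st', gst', w, v, pb', h1, h2, h3, h4⟩ := (hs _).absorb_step hf hl hτ.exec hτe
    (fun p t i h0 => by rwa [hhist] at h0) (hτ.lin.invoke hidle i) hτ.sum
  exact ⟨H ++ w, List.prefix_append _ _, _, st', gst', V ++ v, cb, pb', h1, h2,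
    hτe, Algorithm.endState_concat _ _ _ _, by rwa [hhist], h4⟩

/-- New calls are absorbed against the history without the response, where the operation is still
open. Serialisation of the longer history then forces it to have taken effect with exactly the
response `r`. -/
theorem FullInv.shared_respond (hf : LinearisesShared S f) (hi : FullInv S b f s h H)
    {t : GlobalThread Q} {r : GlobalRes S.State Hint}
    (hstep : S.SharedStep s.globalS t (.res r) s'.globalS)
    (hopen : ∀ {st gst H V cb pb}, SimInv S b s st gst H V cb pb → ∃ p i, (gst t).IsOpen p i)
    (hnext : ∀ {st gst H V cb pb p i}, SimInv S b s st gst H V cb pb → gst t = .done p i r →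
      SimInv S b s' st (Function.update gst t .idle) H V cb pb) :
    ∃ H', H <+: H' ∧ FullInv S b f s' h H' := by
  obtain ⟨τ, st, gst, V, cb, pb, hs, hl, hτ⟩ := hi
  have hτe := hτ.exec_concat hstep (by simp)
  have hhist := S.sharedAlgorithm.history_concat τ (t, .res r, s'.globalS)
  simp only [StepAction.event?, Option.toList_some] at hhist
  obtain ⟨st', gst', w, v, pb', h1, h2, h3, h4⟩ := hs.absorb_step hf hl hτ.exec hτe
    (gh := S.sharedAlgorithm.history τ) (fun p t' i h0 => by
      rw [hhist] at h0
      rcases lt_or_ge p (S.sharedAlgorithm.history τ).length with hp | hp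
      · rwa [List.getElem?_append_left hp] at h0
      · rw [List.getElem?_append_right hp] at h0
        obtain ⟨_, h5⟩ := List.getElem?_eq_some_iff.1 h0
        simp at h5) hτ.lin hτ.sum
  obtain ⟨p, i, hpi⟩ := hopen h1
  have hdone := h3.done_of_respond (by rw [← hhist]; exact hf.ser _ hτe) hpi
  exact ⟨H ++ w, List.prefix_append _ _, _, st', _, V ++ v, cb, pb', hnext h1 hdone, h2,
    hτe, Algorithm.endState_concat _ _ _ _, by rw [hhist]; exact h3.respond hdone, h4⟩

end Shared

/-! ## The steps of the algorithm -/

section Main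

variable {Elem Arg Val Hint Q : Type*} [Zero Hint] [One Hint] [DecidableEq Q] {N : ℕ}

variable {S : ComposableSketch Elem Arg Val Hint Q} {b : ℕ} {s s' : OptState S N}
  {H : SeqHistory (OptThread N Q) (SketchInv Elem Arg) (SketchRes Val)}
  {h : List (Event (OptThread N Q) (SketchInv Elem Arg) (SketchRes Val))}
  {f : List S.sharedAlgorithm.ExecStep →
    SeqHistory (GlobalThread Q) (GlobalInv S.State) (GlobalRes S.State Hint)}

theorem SharedInv.congr {g : S.shared.Config} {τ : List S.sharedAlgorithm.ExecStep}
    {gst : GlobalThread Q → OpStatus (GlobalInv S.State) (GlobalRes S.State Hint)}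
    {A A' : List Elem} (hτ : SharedInv f g τ gst A)
    (hA : ∀ x, S.Summarises x A → S.Summarises x A') : SharedInv f g τ gst A' :=
  { hτ with sum := hA _ hτ.sum }

theorem FullInv.update_step (hb : 0 < b) (hi : FullInv S b f s h H) {i : Fin N}
    {α : StepAction (SketchInv Elem Arg) (SketchRes Val)}
    (hstep : OptStep S N b s (.update i) α s') :
    ∃ H', H <+: H' ∧ FullInv S b f s' (h ++ (α.event? (.update i)).toList) H' := by
  obtain ⟨τ, st, gst, V, cb, pb, hs, hl, hτ⟩ := hi
  obtain ⟨st', w, v, cb', pb', h1, h2, h3, h4⟩ := _root_.update_step hb hstep hs hl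
  exact ⟨H ++ w, List.prefix_append _ _, τ, st', gst, V ++ v, cb', pb', h1, h2,
    h3 ▸ hτ.congr h4⟩

theorem FullInv.propagator_step (hf : LinearisesShared S f) (hi : FullInv S b f s h H)
    {α : StepAction (SketchInv Elem Arg) (SketchRes Val)}
    (hstep : OptStep S N b s .propagator α s') :
    ∃ H', H <+: H' ∧ FullInv S b f s' (h ++ (α.event? .propagator).toList) H' := by
  cases hstep with
  | p_select i hpc hp =>
    obtain ⟨τ, st, gst, V, cb, pb, hs, hl, hτ⟩ := hi
    have hprp := hs.prp
    rw [hpc] at hprp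
    refine ⟨H, List.prefix_refl _, τ, st, gst, V, cb, pb, ?_, by simpa [StepAction.event?] using hl,
      hτ⟩
    have := hs.of_propagator (pPC := .merge i) (o := gst .propagator) s.globalS
      (by rintro _ ⟨⟩; exact hp) (fun k _ hk => by simpa [hpc, Handed] using hk) hprp
    simpa using this
  | p_merge i g hpc hg =>
    obtain ⟨τ, st, gst, V, cb, pb, hs, hl, hτ⟩ := hi
    have hprp := hs.prp
    rw [hpc] at hprp
    have hu := hs.upd i
    have hp := hu.target (by rw [hpc]; rfl)
    have haux := hu.aux.handed hp
    rw [hpc] at haux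
    simp only [StepAction.event?, Option.toList_none, List.append_nil]
    -- `haux` makes the merge admissible: the handed-over sketch summarises a stream.
    refine hτ.invoke (cb := cb) (pb := pb) hf rfl hg ⟨_, haux⟩ hprp hl fun p => ?_
    refine hs.of_propagator g (by rintro _ ⟨⟩; exact hp) (fun k _ hk => ?_) ⟨_, _, Or.inl rfl⟩
    simp only [hpc, Handed] at hk ⊢
    split_ifs with hik
    · subst hik
      exact ⟨_, _, Or.inl ⟨rfl, hk⟩⟩
    · exact hk
  | p_merging i g hpc hg => simpa [StepAction.event?] using hi.shared_tau hf hg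
  | p_merged i g r hpc hg =>
    simp only [StepAction.event?, Option.toList_none, List.append_nil]
    refine hi.shared_respond hf hg (fun hs => ?_) fun hs hd => ?_
    · have hprp := hs.prp
      rw [hpc] at hprp
      obtain ⟨p, x, hx⟩ := hprp
      exact ⟨p, _, hx⟩
    · refine hs.of_propagator g (by rintro _ ⟨⟩; exact (hs.upd i).target (by rw [hpc]; rfl))
        (fun k _ hk => ?_) rfl
      simp only [hpc, Handed] at hk ⊢
      split_ifs at hk ⊢ with hik
      -- A merge that responds has taken effect, so its buffer is already visible and no hidden
      -- stream remains.
      · obtain ⟨_, _, ⟨h1, -⟩ | ⟨_, -, h1⟩⟩ := hk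
        · simp [hd] at h1
        · exact h1
      · exact hk
  | p_emptyLocal i hpc =>
    obtain ⟨τ, st, gst, V, cb, pb, hs, hl, hτ⟩ := hi
    refine ⟨H, List.prefix_refl _, τ, st, gst, V, cb, pb, ⟨hs.split, hs.early, hs.run, fun k => ?_,
      ?_, hs.qry⟩, by simpa [StepAction.event?] using hl, hτ⟩
    · have hu := hs.upd k
      have hi := (hs.upd i).target (by rw [hpc]; rfl)
      rcases eq_or_ne k i with rfl | hk
      · have haux := hu.aux.handed hi
        simp only [hpc, Handed, if_true] at haux
        refine { hu with cur_state := ?_, target := fun _ => hi, aux := ?_ }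
        · simpa [OptState.setLocal] using hu.cur_state
        · refine hu.aux.of_handed hi (fun h0 => absurd hi h0) fun _ => ?_
          simp [Handed, OptState.setLocal, haux]
      · simp only [OptState.setLocal, Function.update_of_ne hk]
        refine hu.imp (by rintro ⟨⟩; exact hi) fun _ h1 => ?_
        simpa [hpc, Handed, hk.symm] using h1
    · have hprp := hs.prp
      rw [hpc] at hprp
      exact hprp
  | p_calcHint i g hpc hg =>
    obtain ⟨τ, st, gst, V, cb, pb, hs, hl, hτ⟩ := hi
    have hprp := hs.prp
    rw [hpc] at hprp
    simp only [StepAction.event?, Option.toList_none, List.append_nil]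
    refine hτ.invoke (cb := cb) (pb := pb) hf rfl hg trivial hprp hl fun p => ?_
    refine hs.of_propagator g (by rintro _ ⟨⟩; exact (hs.upd i).target (by rw [hpc]; rfl))
      (fun k _ hk => ?_) ⟨_, Or.inl rfl⟩
    simpa only [hpc, Handed] using hk
  | p_calculating i g hpc hg => simpa [StepAction.event?] using hi.shared_tau hf hg
  | p_calculated i g x hpc hg =>
    simp only [StepAction.event?, Option.toList_none, List.append_nil]
    refine hi.shared_respond hf hg (fun hs => ?_) fun hs hd => ?_
    · have hprp := hs.prp
      rw [hpc] at hprp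
      obtain ⟨p, hx | ⟨_, hx, -⟩⟩ := hprp
      · exact ⟨p, _, Or.inl hx⟩
      · exact ⟨p, _, Or.inr ⟨_, hx⟩⟩
    · refine hs.of_propagator g (by rintro _ ⟨⟩; exact (hs.upd i).target (by rw [hpc]; rfl))
        (fun k _ hk => ?_) ⟨rfl, ?_⟩
      · simpa only [hpc, Handed] using hk
      · have hprp := hs.prp
        simp only [hpc, PropInv, hd, reduceCtorEq, false_or, OpStatus.done.injEq,
          GlobalRes.hint.injEq] at hprp
        obtain ⟨_, _, ⟨-, -, rfl⟩, hx⟩ := hprp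
        exact hx
  | p_setProp i x hpc =>
    obtain ⟨τ, st, gst, V, cb, pb, hs, hl, hτ⟩ := hi
    have hprp := hs.prp
    rw [hpc] at hprp
    obtain ⟨hidle, hx⟩ := hprp
    refine ⟨H, List.prefix_refl _, τ, st, gst, V, cb, pb, ⟨hs.split, hs.early, hs.run, fun k => ?_,
      hidle, hs.qry⟩, by simpa [StepAction.event?] using hl, hτ⟩
    have hu := hs.upd k
    rcases eq_or_ne k i with rfl | hk
    · have hi := hu.target (by rw [hpc]; rfl)
      have haux := hu.aux.handed hi
      simp only [hpc, Handed, if_true] at haux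
      simp only [Function.update_self]
      -- The hint is nonzero, so writing it to `prop` gives the emptied auxiliary sketch back to the
      -- update thread.
      exact { hu with
        prop_good := fun _ => hx
        target := by rintro ⟨⟩
        aux := hu.aux.of_handed hi (fun _ => haux) fun h0 => absurd h0 hx.1 }
    · simp only [Function.update_of_ne hk]
      refine hu.imp (by rintro ⟨⟩) fun _ h1 => ?_
      simpa [hpc, Handed, hk.symm] using h1

theorem FullInv.query_step (hf : LinearisesShared S f) (hi : FullInv S b f s h H) {j : Q}
    {α : StepAction (SketchInv Elem Arg) (SketchRes Val)}
    (hstep : OptStep S N b s (.query j) α s') :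
    ∃ H', H <+: H' ∧ FullInv S b f s' (h ++ (α.event? (.query j)).toList) H' := by
  cases hstep with
  | q_invoke _ x hpc =>
    obtain ⟨τ, st, gst, V, cb, pb, hs, hl, hτ⟩ := hi
    have hq := hs.qry j
    rw [hpc] at hq
    refine ⟨H, List.prefix_refl _, τ, _, gst, V, cb, pb, ?_, hl.invoke hq.1 _, hτ⟩
    have := hs.of_query j (pc := .snapshot x) (o' := gst (.query j)) s.globalS
      ⟨⟨h.length, rfl⟩, hq.2⟩
    simpa [OptState.gotoQ] using this
  | q_snapshot _ x g hpc hg =>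
    obtain ⟨τ, st, gst, V, cb, pb, hs, hl, hτ⟩ := hi
    have hq := hs.qry j
    rw [hpc] at hq
    obtain ⟨⟨p, hp⟩, hidle⟩ := hq
    simp only [StepAction.event?, Option.toList_none, List.append_nil]
    refine hτ.invoke (cb := cb) (pb := pb) hf rfl hg trivial hidle hl fun p' => ?_
    have := hs.of_query j (pc := .snapshotting x) (o := st (.query j)) g
      (o' := .pending p' .snapshot) ⟨p, p', Or.inl ⟨hp, rfl⟩⟩
    simpa [OptState.gotoQ] using this
  | q_snapshotting _ x g hpc hg => simpa [StepAction.event?] using hi.shared_tau hf hg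
  | q_copied _ x g y hpc hg =>
    simp only [StepAction.event?, Option.toList_none, List.append_nil]
    refine hi.shared_respond hf hg (fun hs => ?_) fun {st _ _ _ _ _ _ _} hs hd => ?_
    · have hq := hs.qry j
      rw [hpc] at hq
      obtain ⟨_, p, ⟨-, hx⟩ | ⟨_, -, hx⟩⟩ := hq
      · exact ⟨p, _, Or.inl hx⟩
      · exact ⟨p, _, Or.inr ⟨_, hx⟩⟩
    · have hq := hs.qry j
      simp only [hpc, QryInv, hd, reduceCtorEq, and_false, false_or, OpStatus.done.injEq,
        GlobalRes.copy.injEq] at hq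
      -- The copy received is the one with which the snapshot took effect, so the value promised in
      -- `H` is the one that will be returned.
      obtain ⟨p, _, _, hq, -, -, rfl⟩ := hq
      have := hs.of_query j (pc := .respond x y) (o := st (.query j)) g (o' := .idle)
        ⟨⟨p, hq⟩, rfl⟩
      simpa [OptState.gotoQ] using this
  | q_respond _ x y hpc =>
    obtain ⟨τ, st, gst, V, cb, pb, hs, hl, hτ⟩ := hi
    have hq := hs.qry j
    rw [hpc] at hq
    obtain ⟨⟨p, hp⟩, hidle⟩ := hq
    refine ⟨H, List.prefix_refl _, τ, _, gst, V, cb, pb, ?_, hl.respond hp, hτ⟩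
    have := hs.of_query j (pc := .idle) (o := .idle) (o' := gst (.query j)) s.globalS
      ⟨rfl, hidle⟩
    simpa [OptState.gotoQ] using this

theorem FullInv.init [NeZero (1 : Hint)] (hb : 0 < b) (hf : LinearisesShared S f) :
    FullInv S b f (OptState.init S N) [] [] := by
  -- Every call of a serialisation is invoked in the history, and the empty history has no
  -- invocations.
  have hnil : f [] = [] := by
    rw [List.eq_nil_iff_forall_not_mem]
    intro c hc
    have := (hf.ser [] trivial).invoked c hc
    simp [Algorithm.history] at this
  refine ⟨[], fun _ => .idle, fun _ => .idle, [], fun _ => [], fun _ => [],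
    ⟨by simp, fun k hk => by simp at hk, trivial, fun i => ?_, rfl, fun j => ⟨rfl, rfl⟩⟩,
    .nil _ _ _, trivial, rfl, ?_, ?_⟩
  · exact
      { op := rfl
        cur_state := rfl
        count := ⟨rfl, hb⟩
        cb_upd := by simp
        pb_upd := by simp
        pb_len := Nat.zero_le _
        hint_good := S.goodHint_one _
        prop_good := fun _ => S.goodHint_one _
        target := by rintro ⟨⟩
        aux := ⟨fun _ => ⟨rfl, rfl⟩, fun _ => rfl⟩ }
  · rw [hnil]
    exact .nil _ _ _
  · rw [hnil]
    rfl

end Main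

theorem mainTheorem1 {Elem Arg Val Hint Q : Type*} [Zero Hint] [One Hint] [NeZero (1 : Hint)]
    [DecidableEq Q] (S : ComposableSketch Elem Arg Val Hint Q) (N b : ℕ) (hb : 0 < b) :
    StronglyLinearisable (OptParSketch S N b)
      (Relaxed (SeqSketch S.toSketchMethods (OptThread N Q)) (2 * N * b)) := by
  obtain ⟨f, hmono, hf⟩ := S.shared_stronglyLinearisable
  have hlin : LinearisesShared S f := ⟨hmono, fun τ hτ => (hf τ hτ).1, fun τ hτ => (hf τ hτ).2⟩
  let A := OptParSketch S N b
  refine stronglyLinearisable_of_simulation A _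
    (fun σ H => FullInv S b f (A.endState A.init σ) (A.history σ) H) [] (.init hb hlin) ?_ ?_
  · rintro σ ⟨t, α, s'⟩ H hσ hi
    have hstep := ((A.isPath_concat _ _ _ _ _).1 hσ).2
    rw [A.endState_concat, A.history_concat]
    cases t with
    | update i => exact hi.update_step hb hstep
    | propagator => exact hi.propagator_step hlin hstep
    | query j => exact hi.query_step hlin hstep
  · rintro σ H ⟨τ, st, gst, V, cb, pb, hs, hl, -⟩
    exact ⟨hs.mem_relaxed (List.Nodup.of_map _ hl.ser.nodup), hl.ser⟩
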